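/- Let $\mathbb{K}$ be an arbitrary field. For $T \in \mathbb{K}^{n_1}\otimes\mathbb{K}^{n_2}\otimes\mathbb{K}^{n_3}$ let the subrank $\mathrm{Q}(T)$ be the largest integer $r \ge 0$ for which there are linear maps $\pi_i : \mathbb{K}^{n_i} \to \mathbb{K}^{r}$ ($i=1,2,3$) with $(\pi_1\otimes\pi_2\otimes\pi_3)T = \sum_{i=1}^{r} e_i\otimes e_i\otimes e_i$. Let $T^{\boxtimes N} \in \mathbb{K}^{n_1^N}\otimes\mathbb{K}^{n_2^N}\otimes\mathbb{K}^{n_3^N}$ be the $N$-th Kronecker power of $T$, that is, $T^{\otimes N}$ regarded as a tensor of order three by grouping together the $N$ copies of each of the three factors and identifying $(\mathbb{K}^{n_i})^{\otimes N}$ with $\mathbb{K}^{n_i^N}$ (for $N=0$ it is the unit tensor $1 \in \mathbb{K}\otimes\mathbb{K}\otimes\mathbb{K}$). **Theorem.** For every nonzero $T \in \mathbb{K}^{n_1}\otimes\mathbb{K}^{n_2}\otimes\mathbb{K}^{n_3}$ exactly one of the following is true: (a) $\mathrm{Q}(T^{\boxtimes N}) = 1$ for all $N$; (b) $\mathrm{Q}(T^{\boxtimes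 N}) = c_3^{N-o(N)}$ for all $N$, where $c_3 = 3/2^{2/3} \approx 1.89$; (c) $\mathrm{Q}(T^{\boxtimes N}) \ge 2^{N-o(N)}$ for all $N$. Here $N$ ranges over the natural numbers, and $o(N)$ stands for a real function $f$ of $N$ (which may depend on $T$) with $f(N)/N \to 0$ as $N \to \infty$. -/

import Mathlib

open scoped TensorProduct

noncomputable section

namespace TensorSubrank

/-- The space `K^{n₁} ⊗ K^{n₂} ⊗ K^{n₃}` of tensors of order three. -/
abbrev Tensor3 (K : Type*) [Field K] (n₁ n₂ n₃ : ℕ) : Type _ :=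
  ((Fin n₁ → K) ⊗[K] (Fin n₂ → K)) ⊗[K] (Fin n₃ → K)

/-- The unit tensor `∑ i, e_i ⊗ e_i ⊗ e_i` in `K^r ⊗ K^r ⊗ K^r`. -/
def unitTensor (K : Type*) [Field K] (r : ℕ) : Tensor3 K r r r :=
  ∑ i : Fin r, ((Pi.single i (1 : K) : Fin r → K) ⊗ₜ[K] (Pi.single i (1 : K) : Fin r → K)) ⊗ₜ[K]
    (Pi.single i (1 : K) : Fin r → K)

/-- `T` restricts to `S`: there are linear maps `π₁, π₂, π₃` with `(π₁ ⊗ π₂ ⊗ π₃) T = S`. -/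
def Restricts {K : Type*} [Field K] {n₁ n₂ n₃ m₁ m₂ m₃ : ℕ}
    (T : Tensor3 K n₁ n₂ n₃) (S : Tensor3 K m₁ m₂ m₃) : Prop :=
  ∃ (π₁ : (Fin n₁ → K) →ₗ[K] (Fin m₁ → K)) (π₂ : (Fin n₂ → K) →ₗ[K] (Fin m₂ → K))
    (π₃ : (Fin n₃ → K) →ₗ[K] (Fin m₃ → K)),
    TensorProduct.map (TensorProduct.map π₁ π₂) π₃ T = S

/-- The subrank: the largest `r` such that `T` restricts to the unit tensor of size `r`.
The set contains `0`, and it is bounded above by each of the dimensions. -/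
def subrank {K : Type*} [Field K] {n₁ n₂ n₃ : ℕ} (T : Tensor3 K n₁ n₂ n₃) : ℕ :=
  sSup {r : ℕ | Restricts T (unitTensor K r)}

/-- The identification of `K^n ⊗ K^m` with `K^{nm}`, taking the basis `e_i ⊗ e_j` to the standard
basis of `K^{nm}`, with the pairs `(i, j)` numbered lexicographically. -/
def pairEquiv (K : Type*) [Field K] (n m : ℕ) :
    ((Fin n → K) ⊗[K] (Fin m → K)) ≃ₗ[K] (Fin (n * m) → K) :=
  (((Pi.basisFun K (Fin n)).tensorProduct (Pi.basisFun K (Fin m))).reindex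
    finProdFinEquiv).equivFun

/-- The Kronecker product `T ⊠ S`: the tensor `T ⊗ S` of order six, regrouped as an element of
`(K^{n₁} ⊗ K^{m₁}) ⊗ (K^{n₂} ⊗ K^{m₂}) ⊗ (K^{n₃} ⊗ K^{m₃})`, with `K^{nᵢ} ⊗ K^{mᵢ}` identified
with `K^{nᵢmᵢ}`. -/
def kronecker {K : Type*} [Field K] {n₁ n₂ n₃ m₁ m₂ m₃ : ℕ}
    (T : Tensor3 K n₁ n₂ n₃) (S : Tensor3 K m₁ m₂ m₃) :
    Tensor3 K (n₁ * m₁) (n₂ * m₂) (n₃ * m₃) :=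
  TensorProduct.map
    (TensorProduct.map (pairEquiv K n₁ m₁).toLinearMap (pairEquiv K n₂ m₂).toLinearMap ∘ₗ
      (TensorProduct.tensorTensorTensorComm K
        (Fin n₁ → K) (Fin n₂ → K) (Fin m₁ → K) (Fin m₂ → K)).toLinearMap)
    (pairEquiv K n₃ m₃).toLinearMap
    (TensorProduct.tensorTensorTensorComm K
      ((Fin n₁ → K) ⊗[K] (Fin n₂ → K)) (Fin n₃ → K)
      ((Fin m₁ → K) ⊗[K] (Fin m₂ → K)) (Fin m₃ → K) (T ⊗ₜ[K] S))

/-- The Kronecker power `T^{⊠N}` in `K^{n₁^N} ⊗ K^{n₂^N} ⊗ K^{n₃^N}`; the power with `N = 0` is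
the unit tensor in `K ⊗ K ⊗ K`. -/
def kroneckerPow {K : Type*} [Field K] {n₁ n₂ n₃ : ℕ} (T : Tensor3 K n₁ n₂ n₃) :
    (N : ℕ) → Tensor3 K (n₁ ^ N) (n₂ ^ N) (n₃ ^ N)
  | 0 => unitTensor K 1
  | N + 1 => kronecker (kroneckerPow T N) T

/-- `a N = c ^ (N - o(N))` for all `N`. -/
def EqPowSubLittleO (a : ℕ → ℕ) (c : ℝ) : Prop :=
  ∃ f : ℕ → ℝ, Asymptotics.IsLittleO Filter.atTop f (fun N : ℕ => (N : ℝ)) ∧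
    ∀ N : ℕ, (a N : ℝ) = c ^ ((N : ℝ) - f N)

/-- `a N ≥ c ^ (N - o(N))` for all `N`. -/
def GePowSubLittleO (a : ℕ → ℕ) (c : ℝ) : Prop :=
  ∃ f : ℕ → ℝ, Asymptotics.IsLittleO Filter.atTop f (fun N : ℕ => (N : ℝ)) ∧
    ∀ N : ℕ, c ^ ((N : ℝ) - f N) ≤ (a N : ℝ)

/-- Exactly one of three propositions holds. -/
def ExactlyOne (A B C : Prop) : Prop :=
  (A ∧ ¬ B ∧ ¬ C) ∨ (¬ A ∧ B ∧ ¬ C) ∨ (¬ A ∧ ¬ B ∧ C)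

end TensorSubrank

end

/-! Mutual restriction preserves the subranks of all powers, so `T` may be replaced by a concise
array `t` (`exists_concise`). If some dimension is 1, slice rank bounds every subrank by 1. If all
dimensions are at least 2 and one is at least 3, then `t` already restricts to the unit tensor of
size 2 (`Concise.restricts_unit_two`), and powers of that give case (c).

There remains the format 2 × 2 × 2, where a concise array is equivalent to the multiplication of an
algebra A = K[s]/(s² - ps - q) (`exists_quad_basis`). If the discriminant p² + 4q is nonzero, A is
étale and A ⊗ A ≅ A × A. Hence t ⊠ t restricts to ⟨2⟩ ⊠ t, and with one copy of t as a catalyst the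
power N + 1 of t restricts to ⟨2⟩^N: case (c) again.

If the discriminant vanishes, A becomes L[s]/(s²) over the algebraic closure L. Tao's slice rank
bound and a Chernoff count then give the upper bound 3 c₃^N. The lower bound has to hold over K
itself. If 2 ≠ 0 the double root lies in K. If 2 = 0 it may not, but A ⊗ A ≅ K[ε]/(ε²) ⊗ A, and the
catalyst argument applies once more. Large unit tensors in the powers of K[s]/(s²) come from random
hashing into Behrend's progression-free sets, in the manner of Strassen and of Coppersmith and
Winograd (`exists_isolated_card_ge`). The cases exclude each other because the rates satisfy 1 < c₃
< 2. -/

open scoped TensorProduct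

namespace TensorSubrank

open Finset

/-! ### Restriction and Kronecker products of coefficient arrays. -/

section Arrays

variable {K : Type*} [Field K]
variable {ι κ μ ι' κ' μ' ι'' κ'' μ'' : Type}

/-- The value of the trilinear form with coefficients `t`. -/
def contract [Fintype ι] [Fintype κ] [Fintype μ] (t : ι → κ → μ → K)
    (x : ι → K) (y : κ → K) (z : μ → K) : K :=
  ∑ a, x a * ∑ b, y b * ∑ c, z c * t a b c

/-- Restriction of arrays of coefficients. -/
def ArrRestricts [Fintype ι] [Fintype κ] [Fintype μ] (t : ι → κ → μ → K)
    (s : ι' → κ' → μ' → K) : Prop :=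
  ∃ (X : ι' → ι → K) (Y : κ' → κ → K) (Z : μ' → μ → K),
    ∀ i j k, contract t (X i) (Y j) (Z k) = s i j k

/-- The cyclic rotation of the three indices. -/
def rotate (t : ι → κ → μ → K) : κ → μ → ι → K := fun b c a => t a b c

/-- The Kronecker product of arrays. -/
def arrKron (t : ι → κ → μ → K) (s : ι' → κ' → μ' → K) :
    ι × ι' → κ × κ' → μ × μ' → K :=
  fun a b c => t a.1 b.1 c.1 * s a.2 b.2 c.2

/-- The Kronecker power of an array. -/
def arrPow (t : ι → κ → μ → K) (N : ℕ) :
    (Fin N → ι) → (Fin N → κ) → (Fin N → μ) → K :=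
  fun a b c => ∏ n, t (a n) (b n) (c n)

/-- The unit array. -/
def arrUnit (K : Type*) [Field K] (ι : Type) [DecidableEq ι] : ι → ι → ι → K :=
  fun i j k => if i = j ∧ j = k then 1 else 0

variable [Fintype ι] [Fintype κ] [Fintype μ]

theorem contract_eq_sum (t : ι → κ → μ → K) (x : ι → K) (y : κ → K) (z : μ → K) :
    contract t x y z = ∑ a, ∑ b, ∑ c, x a * y b * z c * t a b c := by
  simp only [contract, mul_sum, mul_assoc]

theorem contract_rotate (t : ι → κ → μ → K) (x : ι → K) (y : κ → K) (z : μ → K) :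
    contract (rotate t) y z x = contract t x y z := by
  simp only [contract_eq_sum, rotate]
  calc _ = ∑ b, ∑ a, ∑ c, y b * z c * x a * t a b c :=
        sum_congr rfl fun b _ => sum_comm
    _ = ∑ a, ∑ b, ∑ c, y b * z c * x a * t a b c := sum_comm
    _ = _ := sum_congr rfl fun a _ => sum_congr rfl fun b _ => sum_congr rfl fun c _ => by ring

theorem contract_sum_left [Fintype ι'] (t : ι → κ → μ → K) (p : ι' → K) (X : ι' → ι → K)
    (y : κ → K) (z : μ → K) :
    contract t (fun a => ∑ i, p i * X i a) y z = ∑ i, p i * contract t (X i) y z := by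
  simp only [contract, sum_mul]
  rw [sum_comm]
  simp only [mul_sum, mul_assoc]

theorem contract_sum_mid [Fintype κ'] (t : ι → κ → μ → K) (p : κ' → K) (Y : κ' → κ → K)
    (x : ι → K) (z : μ → K) :
    contract t x (fun a => ∑ i, p i * Y i a) z = ∑ i, p i * contract t x (Y i) z := by
  simp only [← contract_rotate t, contract_sum_left]

theorem contract_sum_right [Fintype μ'] (t : ι → κ → μ → K) (p : μ' → K) (Z : μ' → μ → K)
    (x : ι → K) (y : κ → K) :
    contract t x y (fun a => ∑ i, p i * Z i a) = ∑ i, p i * contract t x y (Z i) := by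
  simp only [← contract_rotate t, contract_sum_mid]

theorem contract_single [DecidableEq ι] [DecidableEq κ] [DecidableEq μ] (t : ι → κ → μ → K)
    (a : ι) (b : κ) (c : μ) :
    contract t (Pi.single a 1) (Pi.single b 1) (Pi.single c 1) = t a b c := by
  simp [contract, Pi.single_apply]

theorem ArrRestricts.trans [Fintype ι'] [Fintype κ'] [Fintype μ'] {t : ι → κ → μ → K}
    {s : ι' → κ' → μ' → K} {r : ι'' → κ'' → μ'' → K}
    (h : ArrRestricts t s) (h' : ArrRestricts s r) : ArrRestricts t r := by
  obtain ⟨X, Y, Z, h⟩ := h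
  obtain ⟨X', Y', Z', h'⟩ := h'
  refine ⟨fun i a => ∑ i', X' i i' * X i' a, fun i a => ∑ i', Y' i i' * Y i' a,
    fun i a => ∑ i', Z' i i' * Z i' a, fun i j k => ?_⟩
  rw [contract_sum_left, ← h', contract]
  refine sum_congr rfl fun a _ => ?_
  rw [contract_sum_mid]
  congr 1
  refine sum_congr rfl fun b _ => ?_
  simp only [contract_sum_right, h]

theorem ArrRestricts.of_comp (t : ι → κ → μ → K) (f : ι' → ι) (g : κ' → κ) (h : μ' → μ) :
    ArrRestricts t fun i j k => t (f i) (g j) (h k) := by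
  classical
  exact ⟨fun i => Pi.single (f i) 1, fun j => Pi.single (g j) 1, fun k => Pi.single (h k) 1,
    fun i j k => contract_single _ _ _ _⟩

theorem ArrRestricts.of_eq_comp {t : ι → κ → μ → K} {s : ι' → κ' → μ' → K} (f : ι' → ι)
    (g : κ' → κ) (h : μ' → μ) (H : ∀ i j k, t (f i) (g j) (h k) = s i j k) :
    ArrRestricts t s := by
  convert ArrRestricts.of_comp t f g h using 4
  exact (H _ _ _).symm

theorem ArrRestricts.refl (t : ι → κ → μ → K) : ArrRestricts t t :=
  .of_comp t id id id

theorem ArrRestricts.rotate {t : ι → κ → μ → K} {s : ι' → κ' → μ' → K}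
    (h : ArrRestricts t s) : ArrRestricts (rotate t) (rotate s) := by
  obtain ⟨X, Y, Z, h⟩ := h
  exact ⟨Y, Z, X, fun i j k => by rw [contract_rotate, h]; rfl⟩

theorem contract_arrKron [Fintype ι'] [Fintype κ'] [Fintype μ'] (t : ι → κ → μ → K)
    (s : ι' → κ' → μ' → K) (x : ι → K) (y : κ → K) (z : μ → K)
    (x' : ι' → K) (y' : κ' → K) (z' : μ' → K) :
    contract (arrKron t s) (fun a => x a.1 * x' a.2) (fun a => y a.1 * y' a.2)
      (fun a => z a.1 * z' a.2) = contract t x y z * contract s x' y' z' := by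
  simp only [contract, arrKron, Fintype.sum_prod_type]
  rw [Fintype.sum_mul_sum]
  refine sum_congr rfl fun a _ => sum_congr rfl fun a' _ => ?_
  rw [mul_mul_mul_comm, Fintype.sum_mul_sum]
  congr 1
  refine sum_congr rfl fun b _ => sum_congr rfl fun b' _ => ?_
  rw [mul_mul_mul_comm, Fintype.sum_mul_sum]
  congr 1
  refine sum_congr rfl fun c _ => sum_congr rfl fun c' _ => ?_
  ring

variable {ι₁ κ₁ μ₁ ι₂ κ₂ μ₂ : Type}

theorem ArrRestricts.kron [Fintype ι'] [Fintype κ'] [Fintype μ'] {t : ι → κ → μ → K}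
    {s : ι' → κ' → μ' → K} {t' : ι₁ → κ₁ → μ₁ → K} {s' : ι₂ → κ₂ → μ₂ → K}
    (h : ArrRestricts t t') (h' : ArrRestricts s s') :
    ArrRestricts (arrKron t s) (arrKron t' s') := by
  obtain ⟨X, Y, Z, h⟩ := h
  obtain ⟨X', Y', Z', h'⟩ := h'
  exact ⟨fun i a => X i.1 a.1 * X' i.2 a.2, fun i a => Y i.1 a.1 * Y' i.2 a.2,
    fun i a => Z i.1 a.1 * Z' i.2 a.2, fun i j k => by rw [contract_arrKron, h, h']; rfl⟩

theorem arrPow_succ_restricts_arrKron (t : ι → κ → μ → K) (N : ℕ) :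
    ArrRestricts (arrPow t (N + 1)) (arrKron (arrPow t N) t) := by
  convert ArrRestricts.of_comp (arrPow t (N + 1)) (fun i : (Fin N → ι) × ι => Fin.cons i.2 i.1)
    (fun i : (Fin N → κ) × κ => Fin.cons i.2 i.1) (fun i : (Fin N → μ) × μ => Fin.cons i.2 i.1)
    using 4
  simp [arrPow, arrKron, Fin.prod_univ_succ, mul_comm]

theorem arrKron_restricts_arrPow_succ (t : ι → κ → μ → K) (N : ℕ) :
    ArrRestricts (arrKron (arrPow t N) t) (arrPow t (N + 1)) := by
  convert ArrRestricts.of_comp (arrKron (arrPow t N) t)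
    (fun i : Fin (N + 1) → ι => (Fin.tail i, i 0)) (fun i : Fin (N + 1) → κ => (Fin.tail i, i 0))
    (fun i : Fin (N + 1) → μ => (Fin.tail i, i 0)) using 4
  simp [arrPow, arrKron, Fin.prod_univ_succ, mul_comm, Fin.tail]

theorem arrPow_zero_restricts (t : ι → κ → μ → K) (s : ι' → κ' → μ' → K) :
    ArrRestricts (arrPow t 0) (arrPow s 0) :=
  .of_eq_comp (fun _ => Fin.elim0) (fun _ => Fin.elim0) (fun _ => Fin.elim0) fun _ _ _ => by
    simp [arrPow]

theorem ArrRestricts.pow [Fintype ι'] [Fintype κ'] [Fintype μ'] {t : ι → κ → μ → K}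
    {s : ι' → κ' → μ' → K} (h : ArrRestricts t s) (N : ℕ) :
    ArrRestricts (arrPow t N) (arrPow s N) := by
  induction N with
  | zero => exact arrPow_zero_restricts t s
  | succ N ih =>
    exact ((arrPow_succ_restricts_arrKron t N).trans (ih.kron h)).trans
      (arrKron_restricts_arrPow_succ s N)

omit [Fintype ι] in
theorem arrPow_arrUnit [DecidableEq ι] (N : ℕ) :
    arrPow (arrUnit K ι) N = arrUnit K (Fin N → ι) := by
  funext a b c
  simp only [arrPow, arrUnit, Finset.prod_ite_zero, funext_iff]
  simp [forall_and]

theorem arrUnit_restricts_of_card_le [DecidableEq ι] [Fintype ι'] [DecidableEq ι']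
    (h : Fintype.card ι' ≤ Fintype.card ι) : ArrRestricts (arrUnit K ι) (arrUnit K ι') := by
  obtain ⟨e⟩ := Function.Embedding.nonempty_of_card_le h
  convert ArrRestricts.of_comp (arrUnit K ι) e e e using 4
  simp [arrUnit]

theorem ArrRestricts.pow_unit {t : ι → κ → μ → K} {r : ℕ} (h : ArrRestricts t (arrUnit K (Fin r)))
    (N : ℕ) : ArrRestricts (arrPow t N) (arrUnit K (Fin (r ^ N))) := by
  have := h.pow N
  rw [arrPow_arrUnit] at this
  exact this.trans (arrUnit_restricts_of_card_le (by simp))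

theorem restricts_unit_one_of_ne_zero {t : ι → κ → μ → K} (h : t ≠ 0) :
    ArrRestricts t (arrUnit K (Fin 1)) := by
  classical
  obtain ⟨a, ha⟩ := Function.ne_iff.1 h
  obtain ⟨b, hb⟩ := Function.ne_iff.1 ha
  obtain ⟨c, hc⟩ := Function.ne_iff.1 hb
  refine ⟨fun _ a' => ∑ _i : Fin 1, (t a b c)⁻¹ * Pi.single (M := fun _ => K) a 1 a',
    fun _ => Pi.single b 1, fun _ => Pi.single c 1, fun i j k => ?_⟩
  rw [contract_sum_left]
  have hc : t a b c ≠ 0 := hc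
  simp [contract_single, arrUnit, hc, Subsingleton.elim i j, Subsingleton.elim j k]

/-- If `t ⊠ t` restricts to `s ⊠ t` then `t^(N+1)` restricts to `s^N`. -/
theorem arrPow_succ_restricts_of_arrKron_self [Fintype ι'] [Fintype κ'] [Fintype μ']
    {t : ι → κ → μ → K} {s : ι' → κ' → μ' → K} (ht : t ≠ 0)
    (h : ArrRestricts (arrKron t t) (arrKron s t)) (N : ℕ) :
    ArrRestricts (arrPow t (N + 1)) (arrPow s N) := by
  -- The extra copy of `t` is a catalyst: each use of `h` turns another copy of `t` into `s` and
  -- gives the catalyst back. At the end it is discarded, since a nonzero `t` restricts to the unit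
  -- array of size 1.
  have key : ∀ N, ArrRestricts (arrKron (arrPow t N) t) (arrKron (arrPow s N) t) := by
    intro N
    induction N with
    | zero => exact (arrPow_zero_restricts t s).kron (.refl t)
    | succ N ih =>
      have e₁ : ArrRestricts (arrKron (arrKron (arrPow t N) t) t)
          (arrKron (arrPow t N) (arrKron t t)) :=
        .of_eq_comp (fun i => ((i.1, i.2.1), i.2.2)) (fun i => ((i.1, i.2.1), i.2.2))
          (fun i => ((i.1, i.2.1), i.2.2)) fun _ _ _ => by simp only [arrKron]; ring
      have e₂ : ArrRestricts (arrKron (arrPow t N) (arrKron s t))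
          (arrKron (arrKron (arrPow t N) t) s) :=
        .of_eq_comp (fun i => (i.1.1, (i.2, i.1.2))) (fun i => (i.1.1, (i.2, i.1.2)))
          (fun i => (i.1.1, (i.2, i.1.2))) fun _ _ _ => by simp only [arrKron]; ring
      have e₃ : ArrRestricts (arrKron (arrKron (arrPow s N) t) s)
          (arrKron (arrKron (arrPow s N) s) t) :=
        .of_eq_comp (fun i => ((i.1.1, i.2), i.1.2)) (fun i => ((i.1.1, i.2), i.1.2))
          (fun i => ((i.1.1, i.2), i.1.2)) fun _ _ _ => by simp only [arrKron]; ring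
      exact (((arrPow_succ_restricts_arrKron t N).kron (.refl t)).trans <|
        (e₁.trans ((ArrRestricts.refl _).kron h)).trans <| (e₂.trans (ih.kron (.refl s))).trans <|
        e₃.trans ((arrKron_restricts_arrPow_succ s N).kron (.refl t)))
  refine ((arrPow_succ_restricts_arrKron t N).trans (key N)).trans ?_
  refine ((ArrRestricts.refl (arrPow s N)).kron (restricts_unit_one_of_ne_zero ht)).trans ?_
  convert ArrRestricts.of_comp (arrKron (arrPow s N) (arrUnit K (Fin 1))) (fun i => (i, 0))
    (fun i => (i, 0)) (fun i => (i, 0)) using 4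
  simp [arrKron, arrUnit]

end Arrays

end TensorSubrank

namespace TensorSubrank

open Finset

/-! ### Translation from tensors to arrays. -/

section Coefficients

variable {K : Type*} [Field K] {n₁ n₂ n₃ m₁ m₂ m₃ : ℕ}

/-- The array of coefficients of a tensor in the standard bases. -/
noncomputable def coeff (T : Tensor3 K n₁ n₂ n₃) (i : Fin n₁) (j : Fin n₂) (k : Fin n₃) : K :=
  (((Pi.basisFun K (Fin n₁)).tensorProduct (Pi.basisFun K (Fin n₂))).tensorProduct
    (Pi.basisFun K (Fin n₃))).repr T ((i, j), k)

@[simp] theorem coeff_tmul (x : Fin n₁ → K) (y : Fin n₂ → K) (z : Fin n₃ → K) (i j k) :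
    coeff ((x ⊗ₜ[K] y) ⊗ₜ[K] z) i j k = x i * y j * z k := by
  simp [coeff]; ring

@[simp] theorem coeff_add (T S : Tensor3 K n₁ n₂ n₃) (i j k) :
    coeff (T + S) i j k = coeff T i j k + coeff S i j k := by
  simp [coeff]

@[simp] theorem coeff_zero (i j k) : coeff (0 : Tensor3 K n₁ n₂ n₃) i j k = 0 := by
  rw [coeff, LinearEquiv.map_zero, Finsupp.zero_apply]

theorem coeff_sum {α : Type*} (s : Finset α) (T : α → Tensor3 K n₁ n₂ n₃) (i j k) :
    coeff (∑ a ∈ s, T a) i j k = ∑ a ∈ s, coeff (T a) i j k := by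
  classical
  induction s using Finset.induction_on with
  | empty => simp
  | insert a s h ih => simp [sum_insert h, ih]

theorem coeff_injective : Function.Injective (coeff : Tensor3 K n₁ n₂ n₃ → _) := by
  intro T S h
  refine (((Pi.basisFun K (Fin n₁)).tensorProduct (Pi.basisFun K (Fin n₂))).tensorProduct
    (Pi.basisFun K (Fin n₃))).repr.injective ?_
  ext ⟨⟨i, j⟩, k⟩
  exact congrFun (congrFun (congrFun h i) j) k

/-- Induction over sums of elementary tensors. -/
theorem tensor3_induction {P : Tensor3 K n₁ n₂ n₃ → Prop} (h0 : P 0)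
    (h1 : ∀ x y z, P ((x ⊗ₜ[K] y) ⊗ₜ[K] z)) (h2 : ∀ T S, P T → P S → P (T + S)) (T) : P T := by
  induction T using TensorProduct.induction_on with
  | zero => exact h0
  | add T S hT hS => exact h2 T S hT hS
  | tmul u z =>
    induction u using TensorProduct.induction_on with
    | zero => simpa using h0
    | add u v hu hv => rw [TensorProduct.add_tmul]; exact h2 _ _ hu hv
    | tmul x y => exact h1 x y z

theorem coeff_map (π₁ : (Fin n₁ → K) →ₗ[K] (Fin m₁ → K)) (π₂ : (Fin n₂ → K) →ₗ[K] (Fin m₂ → K))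
    (π₃ : (Fin n₃ → K) →ₗ[K] (Fin m₃ → K)) (T : Tensor3 K n₁ n₂ n₃) (i j k) :
    coeff (TensorProduct.map (TensorProduct.map π₁ π₂) π₃ T) i j k =
      contract (coeff T) (fun a => π₁ (Pi.single a 1) i) (fun a => π₂ (Pi.single a 1) j)
        (fun a => π₃ (Pi.single a 1) k) := by
  induction T using tensor3_induction with
  | h0 => rw [LinearMap.map_zero]; simp [contract]
  | h2 T S hT hS =>
    simp only [map_add, coeff_add, hT, hS]
    simp only [contract, coeff_add, mul_add, sum_add_distrib]
  | h1 x y z =>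
    have key : ∀ {n m : ℕ} (π : (Fin n → K) →ₗ[K] (Fin m → K)) (v : Fin n → K) (i : Fin m),
        π v i = ∑ a, π (Pi.single a 1) i * v a := by
      intro n m π v i
      conv_lhs => rw [← (Pi.basisFun K (Fin n)).sum_repr v]
      simp [mul_comm]
    simp only [TensorProduct.map_tmul, coeff_tmul, contract]
    rw [key π₁ x, key π₂ y, key π₃ z]
    simp only [sum_mul]
    refine sum_congr rfl fun a _ => ?_
    simp only [mul_sum, sum_mul]
    rw [sum_comm]
    refine sum_congr rfl fun b _ => sum_congr rfl fun c _ => ?_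
    ring

theorem coeff_unitTensor (r : ℕ) : coeff (unitTensor K r) = arrUnit K (Fin r) := by
  funext i j k
  simp only [unitTensor, coeff_sum, coeff_tmul, arrUnit, Pi.single_apply]
  rcases eq_or_ne i j with rfl | h
  · simp [eq_comm]
  · rw [if_neg (fun h' => h h'.1)]
    refine sum_eq_zero fun a _ => ?_
    by_cases hi : i = a
    · subst hi; simp [h.symm]
    · simp [hi]

theorem restricts_iff (T : Tensor3 K n₁ n₂ n₃) (S : Tensor3 K m₁ m₂ m₃) :
    Restricts T S ↔ ArrRestricts (coeff T) (coeff S) := by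
  constructor
  · rintro ⟨π₁, π₂, π₃, rfl⟩
    exact ⟨_, _, _, fun i j k => (coeff_map π₁ π₂ π₃ T i j k).symm⟩
  · rintro ⟨X, Y, Z, h⟩
    refine ⟨Matrix.toLin' (Matrix.of X), Matrix.toLin' (Matrix.of Y), Matrix.toLin' (Matrix.of Z),
      coeff_injective ?_⟩
    funext i j k
    rw [coeff_map, ← h]
    simp

theorem coeff_kronecker (T : Tensor3 K n₁ n₂ n₃) (S : Tensor3 K m₁ m₂ m₃) (i j k) :
    coeff (kronecker T S) i j k = arrKron (coeff T) (coeff S) (finProdFinEquiv.symm i)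
      (finProdFinEquiv.symm j) (finProdFinEquiv.symm k) := by
  induction T using tensor3_induction with
  | h0 => simp [kronecker, arrKron]
  | h2 T T' hT hT' =>
    simp only [kronecker, TensorProduct.add_tmul, map_add, coeff_add, arrKron, add_mul] at *
    rw [hT, hT']
  | h1 x y z =>
    induction S using tensor3_induction with
    | h0 => simp [kronecker, arrKron]
    | h2 T T' hT hT' =>
      simp only [kronecker, TensorProduct.tmul_add, map_add, coeff_add, arrKron, mul_add] at *
      rw [hT, hT']
    | h1 x' y' z' =>
      have key : ∀ {n m : ℕ} (x : Fin n → K) (x' : Fin m → K) (i),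
          pairEquiv K n m (x ⊗ₜ[K] x') i
            = x (finProdFinEquiv.symm i).1 * x' (finProdFinEquiv.symm i).2 := by
        intro n m x x' i
        simp [pairEquiv, Module.Basis.equivFun_apply, mul_comm]
      simp only [kronecker, TensorProduct.tensorTensorTensorComm_tmul, TensorProduct.map_tmul,
        LinearMap.comp_apply, LinearEquiv.coe_coe, coeff_tmul, key, arrKron]
      ring

/-- The index types `Fin (n ^ N)` and `Fin N → Fin n` differ, so mutual restriction takes the place
of equality. -/
theorem coeff_kroneckerPow_equiv (T : Tensor3 K n₁ n₂ n₃) (N : ℕ) :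
    ArrRestricts (coeff (kroneckerPow T N)) (arrPow (coeff T) N) ∧
      ArrRestricts (arrPow (coeff T) N) (coeff (kroneckerPow T N)) := by
  induction N with
  | zero =>
    have h : coeff (kroneckerPow T 0) = arrUnit K (Fin 1) := coeff_unitTensor 1
    have h' : ArrRestricts (arrUnit K (Fin 1)) (arrPow (coeff T) 0) :=
      .of_eq_comp (fun _ => 0) (fun _ => 0) (fun _ => 0) fun _ _ _ => by simp [arrPow, arrUnit]
    have h'' : ArrRestricts (arrPow (coeff T) 0) (arrUnit K (Fin 1)) :=
      .of_eq_comp (fun _ => Fin.elim0) (fun _ => Fin.elim0) (fun _ => Fin.elim0)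
        fun i j k => by simp [arrPow, arrUnit, Subsingleton.elim i j, Subsingleton.elim j k]
    rw [h]
    exact ⟨h', h''⟩
  | succ N ih =>
    have h₁ : ArrRestricts (coeff (kroneckerPow T (N + 1)))
        (arrKron (coeff (kroneckerPow T N)) (coeff T)) :=
      .of_eq_comp finProdFinEquiv finProdFinEquiv finProdFinEquiv fun i j k =>
        (coeff_kronecker (kroneckerPow T N) T _ _ _).trans (by simp only [Equiv.symm_apply_apply])
    have h₂ : ArrRestricts (arrKron (coeff (kroneckerPow T N)) (coeff T))
        (coeff (kroneckerPow T (N + 1))) :=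
      .of_eq_comp finProdFinEquiv.symm finProdFinEquiv.symm finProdFinEquiv.symm fun i j k =>
        (coeff_kronecker (kroneckerPow T N) T _ _ _).symm
    exact ⟨(h₁.trans (ih.1.kron (.refl _))).trans (arrKron_restricts_arrPow_succ _ N),
      ((arrPow_succ_restricts_arrKron _ N).trans (ih.2.kron (.refl _))).trans h₂⟩

theorem restricts_kroneckerPow_unitTensor_iff (T : Tensor3 K n₁ n₂ n₃) (N r : ℕ) :
    Restricts (kroneckerPow T N) (unitTensor K r) ↔
      ArrRestricts (arrPow (coeff T) N) (arrUnit K (Fin r)) := by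
  rw [restricts_iff, coeff_unitTensor]
  exact ⟨(coeff_kroneckerPow_equiv T N).2.trans, (coeff_kroneckerPow_equiv T N).1.trans⟩

end Coefficients

/-! ### Tao's slice rank bound. -/

section SliceRank

variable {K : Type*} [Field K]

/-- A vector `v` of maximal support works: if its support had fewer than dim V elements, some
nonzero `u` in `V` would vanish on it, and `v + u` would have larger support. -/
theorem exists_mem_card_support_ge {α : Type} [Fintype α] (V : Submodule K (α → K)) :
    ∃ v ∈ V, Module.finrank K V ≤ Nat.card {i // v i ≠ 0} := by
  classical
  simp only [Nat.card_eq_fintype_card]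
  obtain ⟨v, hv, hmax⟩ : ∃ v ∈ V, ∀ u ∈ V, ({i | u i ≠ 0} : Finset α).card ≤
      ({i | v i ≠ 0} : Finset α).card := by
    have hfin : (Set.range fun u : V => ({i | u.1 i ≠ 0} : Finset α)).Finite := Set.toFinite _
    obtain ⟨_, ⟨⟨v, hv⟩, rfl⟩, h⟩ := hfin.exists_maximalFor Finset.card _ ⟨_, ⟨0, rfl⟩⟩
    refine ⟨v, hv, fun u hu => ?_⟩
    by_contra hlt
    exact hlt (h (j := ({i | u i ≠ 0} : Finset α)) ⟨⟨u, hu⟩, rfl⟩ (le_of_not_ge hlt))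
  refine ⟨v, hv, ?_⟩
  by_contra hlt
  push Not at hlt
  let φ : V →ₗ[K] ({i // v i ≠ 0} → K) := LinearMap.funLeft K K Subtype.val ∘ₗ V.subtype
  have hker : LinearMap.ker φ ≠ ⊥ := by
    intro h
    have := LinearMap.finrank_le_finrank_of_injective (LinearMap.ker_eq_bot.1 h)
    rw [Module.finrank_fintype_fun_eq_card] at this
    omega
  obtain ⟨⟨u, hu⟩, hφ, hne⟩ := (Submodule.ne_bot_iff _).1 hker
  have hzero : ∀ i, v i ≠ 0 → u i = 0 := fun i hi => congrFun hφ ⟨i, hi⟩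
  have hu0 : u ≠ 0 := fun h => hne (Subtype.ext h)
  obtain ⟨i, hi⟩ := Function.ne_iff.1 hu0
  refine absurd (hmax (v + u) (V.add_mem hv hu)) (not_le.2 (card_lt_card ?_))
  rw [ssubset_iff_of_subset]
  · refine ⟨i, ?_, ?_⟩
    · have : v i = 0 := by_contra fun h => hi (hzero i h)
      simpa [this] using hi
    · simpa using by_contra fun h => hi (hzero i h)
  · intro j hj
    simp only [mem_filter, mem_univ, true_and] at hj ⊢
    simpa [hzero j hj] using hj

variable {ι κ μ : Type} [Fintype ι] [Fintype κ] [Fintype μ]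

/-- Tao's bound: the size of a unit tensor is at most its slice rank. -/
theorem le_card_of_restricts_unit (t : ι → κ → μ → K) (L₁ : Finset ι) (L₂ : Finset κ)
    (L₃ : Finset μ) (ht : ∀ a b c, t a b c ≠ 0 → a ∈ L₁ ∨ b ∈ L₂ ∨ c ∈ L₃) {r : ℕ}
    (h : ArrRestricts t (arrUnit K (Fin r))) : r ≤ #L₁ + #L₂ + #L₃ := by
  classical
  obtain ⟨X, Y, Z, h⟩ := h
  let φ : (Fin r → K) →ₗ[K] (L₁ → K) := Matrix.toLin' (Matrix.of fun (a : L₁) i => X i a)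
  -- The combination of the `X i` with coefficients `v` vanishes on `L₁`, and `v` has at least r -
  -- #L₁ nonzero entries.
  obtain ⟨v, hv, hcard⟩ := exists_mem_card_support_ge (LinearMap.ker φ)
  have hdim : r ≤ Module.finrank K (LinearMap.ker φ) + #L₁ := by
    have h1 := LinearMap.finrank_range_add_finrank_ker φ
    have h2 := Submodule.finrank_le (LinearMap.range φ)
    simp only [Module.finrank_fintype_fun_eq_card, Fintype.card_fin, Fintype.card_coe] at h1 h2
    omega
  let x : ι → K := fun a => ∑ i, v i * X i a
  have hx : ∀ a ∈ L₁, x a = 0 := fun a ha => by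
    have := congrFun (show φ v = 0 from hv) ⟨a, ha⟩
    simpa [φ, Matrix.toLin'_apply, Matrix.mulVec, dotProduct, mul_comm, x] using this
  let D : Matrix (Fin r) (Fin r) K := Matrix.diagonal v
  have hD : ∀ j k, D j k = contract t x (Y j) (Z k) := by
    intro j k
    rw [contract_sum_left]
    simp only [h, arrUnit, D, Matrix.diagonal_apply, mul_ite, mul_one, mul_zero]
    rcases eq_or_ne j k with rfl | hjk
    · simp
    · simp [hjk]
  let P : Matrix (Fin r) L₂ K := fun j b => Y j b
  let P' : Matrix L₂ (Fin r) K := fun b k => ∑ a, x a * ∑ c, Z k c * t a b c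
  let R : Matrix (Fin r) L₃ K := fun j c => ∑ a, x a * ∑ b ∈ L₂ᶜ, Y j b * t a b c
  let R' : Matrix L₃ (Fin r) K := fun c k => Z k c
  -- Off `L₁`, each surviving entry of `t` has its second index in `L₂` or its third in `L₃`. The
  -- first kind factors through K^L₂ and the rest through K^L₃, which bounds the rank of `D`; being
  -- diagonal, `D` has rank the size of the support of `v`.
  have hsplit : D = P * P' + R * R' := by
    ext j k
    rw [hD, Matrix.add_apply, Matrix.mul_apply, Matrix.mul_apply]
    have e1 : ∑ b : L₂, P j b * P' b k = ∑ a, x a * ∑ b ∈ L₂, Y j b * ∑ c, Z k c * t a b c := by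
      simp only [P, P']
      rw [Finset.sum_coe_sort L₂ (fun b => Y j b * ∑ a, x a * ∑ c, Z k c * t a b c)]
      simp only [mul_sum]
      rw [sum_comm]
      exact sum_congr rfl fun _ _ => sum_congr rfl fun _ _ => sum_congr rfl fun _ _ => by ring
    have e2 : ∑ c : L₃, R j c * R' c k
        = ∑ a, x a * ∑ b ∈ L₂ᶜ, Y j b * ∑ c ∈ L₃, Z k c * t a b c := by
      simp only [R, R']
      rw [Finset.sum_coe_sort L₃ (fun c => (∑ a, x a * ∑ b ∈ L₂ᶜ, Y j b * t a b c) * Z k c)]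
      simp only [mul_sum, sum_mul]
      rw [sum_comm]
      refine sum_congr rfl fun _ _ => ?_
      rw [sum_comm]
      exact sum_congr rfl fun _ _ => sum_congr rfl fun _ _ => by ring
    rw [e1, e2, ← sum_add_distrib]
    refine sum_congr rfl fun a _ => ?_
    by_cases ha : a ∈ L₁
    · simp [hx a ha]
    rw [← mul_add, ← sum_add_sum_compl L₂]
    congr 2
    refine sum_congr rfl fun b hb => ?_
    congr 1
    symm
    refine sum_subset (subset_univ _) fun c _ hc => ?_
    by_contra hne
    rcases ht a b c (right_ne_zero_of_mul hne) with h | h | h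
    · exact ha h
    · exact (mem_compl.1 hb) h
    · exact hc h
  have hrank : D.rank ≤ #L₂ + #L₃ := by
    rw [hsplit, ← Matrix.fromCols_mul_fromRows]
    exact (Matrix.rank_mul_le_left _ _).trans ((Matrix.rank_le_card_width _).trans (by simp))
  rw [Matrix.rank_diagonal, ← Nat.card_eq_fintype_card] at hrank
  omega

theorem le_card_left_of_restricts_unit {t : ι → κ → μ → K} {r : ℕ}
    (h : ArrRestricts t (arrUnit K (Fin r))) : r ≤ Fintype.card ι := by
  simpa using le_card_of_restricts_unit t univ ∅ ∅ (by simp) h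

end SliceRank

/-! ### Bounds for the subrank of powers. -/

section Subrank

variable {K : Type*} [Field K] {n₁ n₂ n₃ : ℕ}

theorem subrank_kroneckerPow_le (T : Tensor3 K n₁ n₂ n₃) {N R : ℕ}
    (h : ∀ r, ArrRestricts (arrPow (coeff T) N) (arrUnit K (Fin r)) → r ≤ R) :
    subrank (kroneckerPow T N) ≤ R := by
  refine csSup_le' fun r hr => h r ?_
  rwa [← restricts_kroneckerPow_unitTensor_iff]

theorem le_subrank_kroneckerPow (T : Tensor3 K n₁ n₂ n₃) {N r : ℕ}
    (h : ArrRestricts (arrPow (coeff T) N) (arrUnit K (Fin r))) :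
    r ≤ subrank (kroneckerPow T N) := by
  -- In ℕ the supremum of an unbounded set is 0, so a bound must be supplied: the first dimension.
  refine le_csSup ⟨Fintype.card (Fin N → Fin n₁), fun s hs => ?_⟩
    ((restricts_kroneckerPow_unitTensor_iff T N r).2 h)
  exact le_card_left_of_restricts_unit ((restricts_kroneckerPow_unitTensor_iff T N s).1 hs)

end Subrank

end TensorSubrank

namespace TensorSubrank

open Finset

/-! ### Bilinear maps without a unit of size two. -/

section Bilinear

variable {K : Type*} [Field K] {X Y V : Type*} [AddCommGroup X] [Module K X] [AddCommGroup Y]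
  [Module K Y] [AddCommGroup V] [Module K V] (β : X →ₗ[K] Y →ₗ[K] V)

/-- The bilinear map `β` restricts to the componentwise multiplication of `K × K`. -/
def HasUnitTwo : Prop :=
  ∃ (x : Fin 2 → X) (y : Fin 2 → Y) (φ : Fin 2 → V →ₗ[K] K),
    ∀ i j k, φ k (β (x i) (y j)) = if i = j ∧ j = k then 1 else 0

variable {β}

theorem exists_dual_of_not_mem {W : Submodule K V} {v : V} (h : v ∉ W) :
    ∃ φ : V →ₗ[K] K, φ v = 1 ∧ ∀ w ∈ W, φ w = 0 := by
  obtain ⟨f, hf, hW⟩ := Submodule.exists_le_ker_of_notMem h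
  exact ⟨(f v)⁻¹ • f, by simp [hf], fun w hw => by simp [LinearMap.mem_ker.1 (hW hw)]⟩

theorem hasUnitTwo_of {x₁ x₂ : X} {y₁ y₂ : Y}
    (h₁ : β x₁ y₁ ∉ Submodule.span K {β x₂ y₂, β x₁ y₂, β x₂ y₁})
    (h₂ : β x₂ y₂ ∉ Submodule.span K {β x₁ y₁, β x₁ y₂, β x₂ y₁}) : HasUnitTwo β := by
  obtain ⟨φ, hφ, hφ'⟩ := exists_dual_of_not_mem h₁
  obtain ⟨ψ, hψ, hψ'⟩ := exists_dual_of_not_mem h₂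
  have a₁ := hφ' (β x₂ y₂) (Submodule.subset_span (by simp))
  have a₂ := hφ' (β x₁ y₂) (Submodule.subset_span (by simp))
  have a₃ := hφ' (β x₂ y₁) (Submodule.subset_span (by simp))
  have b₁ := hψ' (β x₁ y₁) (Submodule.subset_span (by simp))
  have b₂ := hψ' (β x₁ y₂) (Submodule.subset_span (by simp))
  have b₃ := hψ' (β x₂ y₁) (Submodule.subset_span (by simp))
  refine ⟨![x₁, x₂], ![y₁, y₂], ![φ, ψ], fun i j k => ?_⟩
  fin_cases i <;> fin_cases j <;> fin_cases k <;> simp [*]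

/-- Were β x₁ y' outside, it would be independent of β x₁ y and β x₂ y. Then either β x₂ y' is
independent of these three, or a change of `x₂` and `y'` makes the corresponding product a multiple
of β x₁ y. Both ways `hasUnitTwo_of` applies. -/
theorem mem_span_pair_of_not_hasUnitTwo (hβ : ¬ HasUnitTwo β) {x₁ x₂ : X} {y : Y}
    (hli : LinearIndependent K ![β x₁ y, β x₂ y]) (y' : Y) :
    β x₁ y' ∈ Submodule.span K {β x₁ y, β x₂ y} := by
  by_contra hu
  have key : ∀ a b c : K, a • β x₁ y' + b • β x₁ y + c • β x₂ y = 0 → a = 0 ∧ b = 0 ∧ c = 0 := by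
    intro a b c h
    obtain rfl : a = 0 := by
      by_contra ha
      refine hu (Submodule.mem_span_pair.2 ⟨-(a⁻¹ * b), -(a⁻¹ * c), ?_⟩)
      have := congrArg (a⁻¹ • ·) h
      simp only [smul_add, smul_smul, inv_mul_cancel₀ ha, smul_zero] at this
      linear_combination (norm := module) -this
    exact ⟨rfl, LinearIndependent.pair_iff.1 hli b c (by simpa using h)⟩
  by_cases h4 : β x₂ y' ∈ Submodule.span K {β x₁ y, β x₂ y, β x₁ y'}
  · obtain ⟨α, b, γ, h⟩ := Submodule.mem_span_triple.1 h4
    -- With these shifts the product of `x₂ - γ • x₁` and `y' - b • y` is (α + bγ) β x₁ y, so both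
    -- off-diagonal products lie on the line of β x₁ y.
    refine hβ (hasUnitTwo_of (x₁ := x₂ - γ • x₁) (y₁ := y) (x₂ := x₁) (y₂ := y' - b • y) ?_ ?_)
    · intro hm
      obtain ⟨p, q, r, e⟩ := Submodule.mem_span_triple.1 hm
      simp only [map_sub, map_smul, LinearMap.sub_apply, LinearMap.smul_apply, ← h] at e
      have := key p (-p * b + q * (α + b * γ) + r + γ) (-1) (by
        linear_combination (norm := module) e)
      simp at this
    · intro hm
      obtain ⟨p, q, r, e⟩ := Submodule.mem_span_triple.1 hm
      simp only [map_sub, map_smul, LinearMap.sub_apply, LinearMap.smul_apply, ← h] at e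
      have := key (-1) (-p * γ + q * (α + b * γ) + r + b) p (by
        linear_combination (norm := module) e)
      simp at this
  · have key' : ∀ a b c d : K, a • β x₁ y' + b • β x₁ y + c • β x₂ y + d • β x₂ y' = 0 →
        a = 0 ∧ c = 0 := by
      intro a b c d h
      obtain rfl : d = 0 := by
        by_contra hd
        refine h4 (Submodule.mem_span_triple.2 ⟨-(d⁻¹ * b), -(d⁻¹ * c), -(d⁻¹ * a), ?_⟩)
        have := congrArg (d⁻¹ • ·) h
        simp only [smul_add, smul_smul, inv_mul_cancel₀ hd, smul_zero] at this
        linear_combination (norm := module) -this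
      obtain ⟨ha, -, hc⟩ := key a b c (by simpa using h)
      exact ⟨ha, hc⟩
    refine hβ (hasUnitTwo_of (x₁ := x₂) (y₁ := y) (x₂ := x₁) (y₂ := y') ?_ ?_)
    · intro hm
      obtain ⟨p, q, r, e⟩ := Submodule.mem_span_triple.1 hm
      have := key' p r (-1) q (by linear_combination (norm := module) e)
      simp at this
    · intro hm
      obtain ⟨p, q, r, e⟩ := Submodule.mem_span_triple.1 hm
      have := key' (-1) r p q (by linear_combination (norm := module) e)
      simp at this

/-- A vector outside the line spanned by `w` together with `w` is independent. -/
theorem linearIndependent_pair_of_not_mem {w v : V} (hw : w ≠ 0)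
    (hv : v ∉ Submodule.span K {w}) : LinearIndependent K ![w, v] := by
  rw [LinearIndependent.pair_iff' hw]
  exact fun a h => hv (Submodule.mem_span_singleton.2 ⟨a, h⟩)

theorem mem_span_of_not_linearIndependent {w v : V} (hw : w ≠ 0)
    (h : ¬ LinearIndependent K ![w, v]) : ∃ c : K, v = c • w := by
  by_contra hne
  refine h (linearIndependent_pair_of_not_mem hw fun hm => hne ?_)
  obtain ⟨a, ha⟩ := Submodule.mem_span_singleton.1 hm
  exact ⟨a, ha.symm⟩

/-- Some `β · y` has rank at least two. -/
theorem exists_linearIndependent_left (hX : ∀ x : X, ∃ x', ∀ c : K, x' ≠ c • x)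
    (hleft : ∀ x, (∀ y, β x y = 0) → x = 0) {x₀ x₁ : X} {y₀ y₁ : Y}
    (hli : LinearIndependent K ![β x₀ y₀, β x₁ y₁]) :
    ∃ x x' y, LinearIndependent K ![β x y, β x' y] := by
  -- Suppose all β · y have rank at most one. The images of β · y₀ and β · y₁ are different lines,
  -- so the rank of β · (y₀ + y₁) forces equal kernels, and some `u ≠ 0` is killed by both. Choose
  -- `y` with β u y ≠ 0: the ranks of β · (y + y₀) and β · (y + y₁) then put both lines into the
  -- span of β u y.
  by_contra! hne
  have dep : ∀ {x x' y}, β x y ≠ 0 → ∃ c : K, β x' y = c • β x y := fun {x x' y} h =>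
    mem_span_of_not_linearIndependent h (hne x x' y)
  have hw₀ : β x₀ y₀ ≠ 0 := hli.ne_zero 0
  have hw₁ : β x₁ y₁ ≠ 0 := hli.ne_zero 1
  have hpair : ∀ s t : K, s • β x₀ y₀ + t • β x₁ y₁ = 0 → s = 0 ∧ t = 0 :=
    LinearIndependent.pair_iff.1 hli
  obtain ⟨b, hb⟩ := dep (x' := x₁) hw₀
  obtain ⟨a, ha⟩ := dep (x' := x₀) hw₁
  have hne' : β x₀ (y₀ + y₁) ≠ 0 := by
    intro h
    rw [map_add, ha] at h
    simpa using (hpair 1 a (by simpa using h)).1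
  obtain ⟨x₂, hx₂⟩ := hX x₀
  obtain ⟨e, he⟩ := dep (x' := x₁) hne'
  have ha0 : a ≠ 0 := by
    rintro rfl
    rw [map_add, map_add, hb, ha] at he
    have := hpair (b - e) 1 (by linear_combination (norm := module) he)
    simp at this
  obtain ⟨c, hc⟩ := dep (x' := x₂) hw₀
  obtain ⟨d, hd⟩ := dep (x' := x₂) hw₁
  obtain ⟨f, hf⟩ := dep (x' := x₂) hne'
  rw [map_add, map_add, hc, hd, ha] at hf
  have hcd := hpair (c - f) (d - f * a) (by linear_combination (norm := module) hf)
  have hcf : c = f := sub_eq_zero.1 hcd.1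
  have hdf : d = f * a := sub_eq_zero.1 hcd.2
  subst hcf hdf
  have hu : x₂ - c • x₀ ≠ 0 := sub_ne_zero.2 (hx₂ c)
  obtain ⟨y, hy⟩ : ∃ y, β (x₂ - c • x₀) y ≠ 0 := by
    by_contra! h
    exact hu (hleft _ h)
  set u := x₂ - c • x₀ with hu_def
  have hu₀ : β u y₀ = 0 := by simp [hu_def, hc]
  have hu₁ : β u y₁ = 0 := by
    simp only [hu_def, map_sub, map_smul, LinearMap.sub_apply, LinearMap.smul_apply, hd, ha]
    module
  obtain ⟨g, hg⟩ := dep (x' := x₀) hy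
  obtain ⟨p, hp⟩ := dep (x := u) (x' := x₀) (y := y + y₀) (by rw [map_add, hu₀, add_zero]; exact hy)
  obtain ⟨q, hq⟩ := dep (x := u) (x' := x₀) (y := y + y₁) (by rw [map_add, hu₁, add_zero]; exact hy)
  rw [map_add, map_add, hu₀, hg, add_zero] at hp
  rw [map_add, map_add, hu₁, hg, add_zero, ha] at hq
  have e₀ : β x₀ y₀ = (p - g) • β u y := by linear_combination (norm := module) hp
  have e₁ : a • β x₁ y₁ = (q - g) • β u y := by linear_combination (norm := module) hq
  have h1 := hpair (q - g) (-((p - g) * a)) (by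
    rw [neg_smul, mul_smul, e₁, e₀]; module)
  rcases mul_eq_zero.1 (neg_eq_zero.1 h1.2) with h | h
  · rw [h, zero_smul] at e₀; exact hw₀ e₀
  · exact ha0 h

/-- Not all the maps `β · y'` are multiples of one map `β · y` of rank at least two. -/
theorem exists_not_mem_span (hY : ∀ y : Y, ∃ y', ∀ c : K, y' ≠ c • y)
    (hright : ∀ y, (∀ x, β x y = 0) → y = 0) {x₁ x₂ : X} {y : Y}
    (hli : LinearIndependent K ![β x₁ y, β x₂ y]) :
    ∃ x y', β x y' ∉ Submodule.span K {β x y} := by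
  by_contra! hR
  have R : ∀ x y', ∃ c : K, β x y' = c • β x y := fun x y' => by
    obtain ⟨c, hc⟩ := Submodule.mem_span_singleton.1 (hR x y')
    exact ⟨c, hc.symm⟩
  have hpair : ∀ s t : K, s • β x₁ y + t • β x₂ y = 0 → s = 0 ∧ t = 0 :=
    LinearIndependent.pair_iff.1 hli
  have hw₁ : β x₁ y ≠ 0 := hli.ne_zero 0
  obtain ⟨y', hy'⟩ := hY y
  obtain ⟨l, hl⟩ := R x₁ y'
  have hz : y' - l • y ≠ 0 := sub_ne_zero.2 (hy' l)
  refine hz (hright _ fun x => ?_)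
  set z := y' - l • y with hz_def
  have h₁ : β x₁ z = 0 := by simp [hz_def, hl]
  have step : ∀ x, (∀ c : K, β x y ≠ c • β x₁ y) → β x z = 0 := by
    intro x hx
    obtain ⟨m, hm⟩ := R x z
    obtain ⟨n, hn⟩ := R (x + x₁) z
    simp only [map_add, LinearMap.add_apply, h₁, hm, add_zero] at hn
    by_cases hmn : m = n
    · subst hmn
      have : m • β x₁ y = 0 := by linear_combination (norm := module) -hn
      rw [hm, (smul_eq_zero.1 this).resolve_right hw₁, zero_smul]
    · refine absurd ?_ (hx (n / (m - n)))
      have h' : m - n ≠ 0 := sub_ne_zero.2 hmn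
      have := congrArg ((m - n)⁻¹ • ·) hn
      have e : (m - n) • β x y = n • β x₁ y := by linear_combination (norm := module) hn
      rw [div_eq_inv_mul, mul_smul, ← e, smul_smul, inv_mul_cancel₀ h', one_smul]
  by_cases hx : ∀ c : K, β x y ≠ c • β x₁ y
  · exact step x hx
  · push Not at hx
    obtain ⟨c, hc⟩ := hx
    obtain ⟨m, hm⟩ := R (x - c • x₁) z
    simpa [hc, h₁] using hm

/-- Without a unit of size two, some β · y has rank at least three. Then β u y' lies in two
different planes through β u y, hence on the line of β u y. This holds for all u and y', against
`exists_not_mem_span`. The hypotheses `hX`, `hY`, `hspan` stand for dimensions at least 2, 2, 3. -/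
theorem hasUnitTwo_of_three_le (hX : ∀ x : X, ∃ x', ∀ c : K, x' ≠ c • x)
    (hY : ∀ y : Y, ∃ y', ∀ c : K, y' ≠ c • y)
    (hleft : ∀ x, (∀ y, β x y = 0) → x = 0) (hright : ∀ y, (∀ x, β x y = 0) → y = 0)
    (hspan : ∀ v w : V, ∃ x y, β x y ∉ Submodule.span K {v, w}) : HasUnitTwo β := by
  by_contra hβ
  obtain ⟨x₀, y₀, h₀⟩ := hspan 0 0
  obtain ⟨x₁, y₁, h₁⟩ := hspan (β x₀ y₀) 0
  obtain ⟨x, x', y, hli⟩ := exists_linearIndependent_left hX hleft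
    (linearIndependent_pair_of_not_mem (w := β x₀ y₀) (v := β x₁ y₁)
      (fun h => h₀ (by simp [h]))
      (fun h => h₁ (Submodule.span_mono (by simp) h)))
  have key : ∀ {u v : X}, LinearIndependent K ![β u y, β v y] → ∀ y',
      β u y' ∈ Submodule.span K {β u y, β v y} := fun h => mem_span_pair_of_not_hasUnitTwo hβ h
  have key' : ∀ {u v : X}, LinearIndependent K ![β u y, β v y] → ∀ y',
      β v y' ∈ Submodule.span K {β u y, β v y} := fun h y' => by
    rw [Set.pair_comm]
    exact key (LinearIndependent.pair_symm_iff.1 h) y'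
  -- the rank of `β · y` is at least three
  obtain ⟨x₃, h₃⟩ : ∃ x₃, β x₃ y ∉ Submodule.span K {β x y, β x' y} := by
    by_contra! hall
    obtain ⟨u, y', hu⟩ := hspan (β x y) (β x' y)
    obtain ⟨a, b, hab⟩ := Submodule.mem_span_pair.1 (hall u)
    -- Adding this kernel vector to `x` does not change the pair β x y, β x' y, so its product with
    -- `y'` stays in their plane.
    have hk : β (u - a • x - b • x') y = 0 := by simp [← hab]
    have hk' := key (u := x + (u - a • x - b • x')) (v := x')
      (by rwa [map_add, LinearMap.add_apply, hk, add_zero]) y'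
    have hx := key hli y'
    have hx' := key' hli y'
    rw [map_add, LinearMap.add_apply, LinearMap.add_apply, hk, add_zero] at hk'
    have e : β u y' = (β x y' + β (u - a • x - b • x') y') + (a - 1) • β x y' + b • β x' y' := by
      simp only [map_sub, map_smul, LinearMap.sub_apply, LinearMap.smul_apply]; module
    rw [e] at hu
    exact hu (add_mem (add_mem hk' (Submodule.smul_mem _ _ hx)) (Submodule.smul_mem _ _ hx'))
  have indep : ∀ {w v v' : V}, LinearIndependent K ![v, v'] → w ∉ Submodule.span K {v, v'} →
      ∀ a b c : K, a • w + b • v + c • v' = 0 → a = 0 ∧ b = 0 ∧ c = 0 := by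
    intro w v v' hv hw a b c h
    obtain rfl : a = 0 := by
      by_contra ha
      refine hw (Submodule.mem_span_pair.2 ⟨-(a⁻¹ * b), -(a⁻¹ * c), ?_⟩)
      have := congrArg (a⁻¹ • ·) h
      simp only [smul_add, smul_smul, inv_mul_cancel₀ ha, smul_zero] at this
      linear_combination (norm := module) -this
    exact ⟨rfl, LinearIndependent.pair_iff.1 hv b c (by simpa using h)⟩
  have triple : ∀ {u v v' : X}, LinearIndependent K ![β v y, β v' y] →
      β u y ∉ Submodule.span K {β v y, β v' y} → ∀ y', β u y' ∈ Submodule.span K {β u y} := by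
    intro u v v' hv hu y'
    have h3 := indep hv hu
    obtain ⟨a, b, hab⟩ := Submodule.mem_span_pair.1 (key (u := u) (v := v)
      (LinearIndependent.pair_iff.2 fun s t h => by
        have := h3 s t 0 (by simpa using h); exact ⟨this.1, this.2.1⟩) y')
    obtain ⟨c, d, hcd⟩ := Submodule.mem_span_pair.1 (key (u := u) (v := v')
      (LinearIndependent.pair_iff.2 fun s t h => by
        have := h3 s 0 t (by simpa using h); exact ⟨this.1, this.2.2⟩) y')
    have hb := (h3 (a - c) b (-d) (by linear_combination (norm := module) hab - hcd)).2.1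
    refine Submodule.mem_span_singleton.2 ⟨a, ?_⟩
    simpa [hb] using hab
  have three := indep hli h₃
  have mem₁ : β x y ∉ Submodule.span K {β x' y, β x₃ y} := fun h => by
    obtain ⟨a, b, hab⟩ := Submodule.mem_span_pair.1 h
    simpa using (three b (-1) a (by linear_combination (norm := module) hab)).2.1
  have mem₂ : β x' y ∉ Submodule.span K {β x y, β x₃ y} := fun h => by
    obtain ⟨a, b, hab⟩ := Submodule.mem_span_pair.1 h
    simpa using (three b a (-1) (by linear_combination (norm := module) hab)).2.2
  have li₁ : LinearIndependent K ![β x' y, β x₃ y] := LinearIndependent.pair_iff.2 fun s t h => by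
    have := three t 0 s (by linear_combination (norm := module) h)
    exact ⟨this.2.2, this.1⟩
  have li₂ : LinearIndependent K ![β x y, β x₃ y] := LinearIndependent.pair_iff.2 fun s t h => by
    have := three t s 0 (by linear_combination (norm := module) h)
    exact ⟨this.2.1, this.1⟩
  obtain ⟨u, y', hu⟩ := exists_not_mem_span hY hright hli
  apply hu
  -- If β u y avoids one of the three coordinate planes, `triple` applies; otherwise it is zero.
  by_cases hu₁ : β u y ∈ Submodule.span K {β x' y, β x₃ y}
  swap
  · exact triple li₁ hu₁ y'
  by_cases hu₂ : β u y ∈ Submodule.span K {β x y, β x₃ y}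
  swap
  · exact triple li₂ hu₂ y'
  by_cases hu₃ : β u y ∈ Submodule.span K {β x y, β x' y}
  swap
  · exact triple hli hu₃ y'
  have hzero : β u y = 0 := by
    obtain ⟨a, b, h₁⟩ := Submodule.mem_span_pair.1 hu₁
    obtain ⟨c, d, h₂⟩ := Submodule.mem_span_pair.1 hu₂
    obtain ⟨e, f, h₃⟩ := Submodule.mem_span_pair.1 hu₃
    have i₁ := three (b - d) (-c) a (by linear_combination (norm := module) h₁ - h₂)
    have i₂ := three b (-e) (a - f) (by linear_combination (norm := module) h₁ - h₃)
    rw [← h₁, i₁.2.2, i₂.1]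
    simp
  -- When β u y = 0, shifting `x` and `x'` by `u` places β u y' on two different lines.
  have hx₁ : β u y' ∈ Submodule.span K {β x y} := by
    have h := triple (u := x + u) li₁ (by simpa [hzero] using mem₁) y'
    rw [map_add, LinearMap.add_apply, LinearMap.add_apply, hzero, add_zero] at h
    exact (Submodule.add_mem_iff_right _ (triple li₁ mem₁ y')).1 h
  have hx₂ : β u y' ∈ Submodule.span K {β x' y} := by
    have h := triple (u := x' + u) li₂ (by simpa [hzero] using mem₂) y'
    rw [map_add, LinearMap.add_apply, LinearMap.add_apply, hzero, add_zero] at h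
    exact (Submodule.add_mem_iff_right _ (triple li₂ mem₂ y')).1 h
  obtain ⟨a, ha⟩ := Submodule.mem_span_singleton.1 hx₁
  obtain ⟨b, hb⟩ := Submodule.mem_span_singleton.1 hx₂
  have := three 0 a (-b) (by linear_combination (norm := module) ha - hb)
  rw [← ha, this.2.1, zero_smul]
  exact Submodule.zero_mem _

end Bilinear
end TensorSubrank

namespace TensorSubrank

open Finset

/-! ### Concise bilinear maps of format 2 × 2 × 2. -/

section NormalForm

variable {K : Type*} [Field K]

/-- The structure constants of the algebra `K[s] / (s² - p s - q)` in the basis `1, s`. -/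
def quadArr (p q : K) (i j k : Fin 2) : K :=
  (![![![1, 0], ![0, 1]], ![![0, 1], ![q, p]]] : Fin 2 → Fin 2 → Fin 2 → K) i j k

theorem exists_ne_smul_of_two_le_finrank {X : Type*} [AddCommGroup X] [Module K X]
    (h : 2 ≤ Module.finrank K X) (x : X) : ∃ x', ∀ c : K, x' ≠ c • x := by
  by_contra! hne
  have := finrank_le_one (R := K) x fun w => by
    obtain ⟨c, hc⟩ := hne w
    exact ⟨c, hc.symm⟩
  omega

/-- Some β · y is bijective, and some β u y' is not a multiple of β u y. Choose u' with β u' y = β u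
y'. Then `u`, `y` play the role of 1 and `u'`, `y'` that of s, and only the square β u' y' is free;
its coordinates are q and p. -/
theorem exists_quad_basis {X Y V : Type*} [AddCommGroup X] [Module K X] [AddCommGroup Y]
    [Module K Y] [AddCommGroup V] [Module K V] {β : X →ₗ[K] Y →ₗ[K] V}
    (hX : Module.finrank K X = 2) (hY : Module.finrank K Y = 2) (hV : Module.finrank K V = 2)
    (hleft : ∀ x, (∀ y, β x y = 0) → x = 0) (hright : ∀ y, (∀ x, β x y = 0) → y = 0)
    (hspan : ∀ v : V, ∃ x y, β x y ∉ Submodule.span K {v}) :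
    ∃ (p q : K) (bX : Module.Basis (Fin 2) K X) (bY : Module.Basis (Fin 2) K Y)
      (bV : Module.Basis (Fin 2) K V),
      ∀ i j, β (bX i) (bY j) = ∑ k, quadArr p q i j k • bV k := by
  have := FiniteDimensional.of_finrank_pos (K := K) (V := X) (by omega)
  have := FiniteDimensional.of_finrank_pos (K := K) (V := Y) (by omega)
  have := FiniteDimensional.of_finrank_pos (K := K) (V := V) (by omega)
  obtain ⟨x₀, y₀, h₀⟩ := hspan 0
  obtain ⟨x₁, y₁, h₁⟩ := hspan (β x₀ y₀)
  obtain ⟨x, x', y, hli⟩ := exists_linearIndependent_left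
    (exists_ne_smul_of_two_le_finrank hX.ge) hleft
    (linearIndependent_pair_of_not_mem (fun h => h₀ (by simp [h])) h₁)
  obtain ⟨u, y', hu⟩ := exists_not_mem_span (exists_ne_smul_of_two_le_finrank hY.ge) hright hli
  have hsurj : Function.Surjective (β.flip y) := by
    rw [← LinearMap.range_eq_top]
    refine Submodule.eq_top_of_finrank_eq (le_antisymm (Submodule.finrank_le _) ?_)
    rw [hV, ← Fintype.card_fin 2, ← finrank_span_eq_card hli]
    refine Submodule.finrank_mono (Submodule.span_le.2 ?_)
    rintro _ ⟨i, rfl⟩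
    fin_cases i
    exacts [⟨x, rfl⟩, ⟨x', rfl⟩]
  have hinj : Function.Injective (β.flip y) :=
    (LinearMap.injective_iff_surjective_of_finrank_eq_finrank (hX.trans hV.symm)).2 hsurj
  have hu0 : β u y ≠ 0 := by
    intro h
    have : u = 0 := hinj (by simpa using h)
    exact hu (by simp [this])
  have hv : LinearIndependent K ![β u y, β u y'] := linearIndependent_pair_of_not_mem hu0 hu
  obtain ⟨u', hu'⟩ : ∃ u', β u' y = β u y' := hsurj (β u y')
  have hpair := LinearIndependent.pair_iff.1 hv
  have hxli : LinearIndependent K ![u, u'] := LinearIndependent.pair_iff.2 fun s t h => by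
    refine hpair s t ?_
    have := congrArg (fun w => β w y) h
    simpa [hu'] using this
  have hyli : LinearIndependent K ![y, y'] := LinearIndependent.pair_iff.2 fun s t h => by
    refine hpair s t ?_
    have := congrArg (fun w => β u w) h
    simpa using this
  let bX := basisOfLinearIndependentOfCardEqFinrank hxli (by simp [hX])
  let bY := basisOfLinearIndependentOfCardEqFinrank hyli (by simp [hY])
  let bV := basisOfLinearIndependentOfCardEqFinrank hv (by simp [hV])
  refine ⟨bV.repr (β u' y') 1, bV.repr (β u' y') 0, bX, bY, bV, fun i j => ?_⟩
  have hsum := bV.sum_repr (β u' y')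
  rw [Fin.sum_univ_two] at hsum
  have e : ∀ i, bV i = ![β u y, β u y'] i := fun i => by simp [bV]
  rw [Fin.sum_univ_two, show bX i = ![u, u'] i by simp [bX], show bY j = ![y, y'] j by simp [bY]]
  fin_cases i <;> fin_cases j <;> simp [quadArr, e, hu']
  simpa [e] using hsum.symm

end NormalForm

/-! ### Concise arrays. -/

section Concise

variable {K : Type*} [Field K] {ι κ μ : Type} [Fintype ι] [Fintype κ] [Fintype μ]

/-- The bilinear map with structure constants `t`. -/
noncomputable def arrBilin (t : ι → κ → μ → K) : (ι → K) →ₗ[K] (κ → K) →ₗ[K] (μ → K) :=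
  LinearMap.mk₂ K (fun x y => ∑ a, ∑ b, (x a * y b) • t a b)
    (fun x x' y => by simp [add_mul, add_smul, sum_add_distrib])
    (fun c x y => by simp [mul_assoc, mul_smul, smul_sum])
    (fun x y y' => by simp [mul_add, add_smul, sum_add_distrib])
    (fun c x y => by simp [mul_left_comm, mul_smul, smul_sum])

omit [Fintype μ] in
theorem arrBilin_apply (t : ι → κ → μ → K) (x : ι → K) (y : κ → K) :
    arrBilin t x y = ∑ a, ∑ b, (x a * y b) • t a b := rfl

theorem contract_eq_dual [DecidableEq μ] (t : ι → κ → μ → K) (x : ι → K) (y : κ → K)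
    (φ : (μ → K) →ₗ[K] K) :
    contract t x y (fun c => φ (Pi.single c 1)) = φ (arrBilin t x y) := by
  rw [arrBilin_apply, contract_eq_sum, map_sum]
  refine sum_congr rfl fun a _ => ?_
  rw [map_sum]
  refine sum_congr rfl fun b _ => ?_
  rw [map_smul, smul_eq_mul]
  conv_rhs => rw [← (Pi.basisFun K μ).sum_repr (t a b)]
  simp only [map_sum, map_smul, mul_sum, Pi.basisFun_apply, Pi.basisFun_repr, smul_eq_mul]
  exact sum_congr rfl fun c _ => by ring

/-- An array is concise if its slices in each direction are linearly independent. -/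
def Concise (t : ι → κ → μ → K) : Prop :=
  LinearIndependent K t ∧ LinearIndependent K (rotate t) ∧
    LinearIndependent K (rotate (rotate t))

omit [Fintype ι] [Fintype κ] [Fintype μ] in
theorem Concise.rotate {t : ι → κ → μ → K} (h : Concise t) : Concise (rotate t) :=
  ⟨h.2.1, h.2.2, h.1⟩

omit [Fintype μ] in
theorem Concise.left {t : ι → κ → μ → K} (h : Concise t) (x : ι → K)
    (hx : ∀ y, arrBilin t x y = 0) : x = 0 := by
  classical
  funext a
  refine Fintype.linearIndependent_iff.1 h.1 x ?_ a
  funext b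
  simpa [arrBilin_apply, Pi.single_apply, Finset.sum_apply] using hx (Pi.single b 1)

omit [Fintype μ] in
theorem Concise.right {t : ι → κ → μ → K} (h : Concise t) (y : κ → K)
    (hy : ∀ x, arrBilin t x y = 0) : y = 0 := by
  classical
  funext b
  refine Fintype.linearIndependent_iff.1 h.2.1 y ?_ b
  funext c a
  have := congrFun (hy (Pi.single a 1)) c
  simp only [arrBilin_apply, Finset.sum_apply, Pi.smul_apply, Pi.single_apply, smul_eq_mul] at this
  simpa [TensorSubrank.rotate, Finset.sum_apply] using this

/-- If all products lay in `W`, a nonzero functional vanishing on `W` would be a linear relation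
between the slices in the third direction. -/
theorem Concise.exists_not_mem {t : ι → κ → μ → K} (h : Concise t) {W : Submodule K (μ → K)}
    (hW : Module.finrank K W < Fintype.card μ) : ∃ x y, arrBilin t x y ∉ W := by
  classical
  by_contra! hall
  obtain ⟨φ, hφ, hle⟩ := Submodule.exists_le_ker_of_lt_top W (lt_top_iff_ne_top.2 fun hT => by
    rw [hT, finrank_top, Module.finrank_fintype_fun_eq_card] at hW
    exact lt_irrefl _ hW)
  refine hφ ((Pi.basisFun K μ).ext fun c => ?_)
  have := Fintype.linearIndependent_iff.1 h.2.2 (fun c => φ (Pi.single c 1)) (by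
    funext a b
    have := contract_eq_dual t (Pi.single a 1) (Pi.single b 1) φ
    rw [LinearMap.mem_ker.1 (hle (hall _ _))] at this
    simpa [contract, Pi.single_apply, TensorSubrank.rotate, Finset.sum_apply] using this) c
  simpa using this

theorem Concise.restricts_unit_two_of_three_le_right {t : ι → κ → μ → K} (h : Concise t)
    (h₁ : 2 ≤ Fintype.card ι) (h₂ : 2 ≤ Fintype.card κ) (h₃ : 3 ≤ Fintype.card μ) :
    ArrRestricts t (arrUnit K (Fin 2)) := by
  classical
  obtain ⟨x, y, φ, hφ⟩ := hasUnitTwo_of_three_le (β := arrBilin t)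
    (exists_ne_smul_of_two_le_finrank (by simpa using h₁))
    (exists_ne_smul_of_two_le_finrank (by simpa using h₂)) h.left h.right
    (fun v w => h.exists_not_mem (lt_of_le_of_lt (finrank_span_le_card _) (by
      have : #(({v, w} : Set (μ → K)).toFinset) ≤ 2 := by simpa using card_le_two
      omega)))
  exact ⟨x, y, fun k c => φ k (Pi.single c 1), fun i j k => by
    rw [contract_eq_dual, hφ]; rfl⟩

theorem Concise.restricts_unit_two {t : ι → κ → μ → K} (h : Concise t)
    (h₁ : 2 ≤ Fintype.card ι) (h₂ : 2 ≤ Fintype.card κ) (h₃ : 2 ≤ Fintype.card μ)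
    (h₄ : 3 ≤ Fintype.card ι ∨ 3 ≤ Fintype.card κ ∨ 3 ≤ Fintype.card μ) :
    ArrRestricts t (arrUnit K (Fin 2)) := by
  have hrot : TensorSubrank.rotate (arrUnit K (Fin 2)) = arrUnit K (Fin 2) := by
    funext i j k
    simp only [TensorSubrank.rotate, arrUnit]
    exact if_congr (by constructor <;> rintro ⟨rfl, rfl⟩ <;> simp) rfl rfl
  rcases h₄ with h₄ | h₄ | h₄
  · have := (h.rotate.restricts_unit_two_of_three_le_right h₂ h₃ h₄).rotate.rotate
    rwa [hrot, hrot] at this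
  · have := (h.rotate.rotate.restricts_unit_two_of_three_le_right h₃ h₁ h₄).rotate
    rwa [hrot] at this
  · exact h.restricts_unit_two_of_three_le_right h₁ h₂ h₄

theorem Concise.exists_quadArr {t : ι → κ → μ → K} (h : Concise t)
    (h₁ : Fintype.card ι = 2) (h₂ : Fintype.card κ = 2) (h₃ : Fintype.card μ = 2) :
    ∃ p q : K, ArrRestricts t (quadArr p q) ∧ ArrRestricts (quadArr p q) t := by
  classical
  obtain ⟨p, q, bX, bY, bV, hb⟩ := exists_quad_basis (β := arrBilin t) (by simpa using h₁)
    (by simpa using h₂) (by simpa using h₃) h.left h.right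
    (fun v => h.exists_not_mem (lt_of_le_of_lt (finrank_span_le_card _) (by simp [h₃])))
  refine ⟨p, q, ⟨bX, bY, fun k c => bV.coord k (Pi.single c 1), fun i j k => ?_⟩,
    ⟨fun a i => bX.repr (Pi.single a 1) i, fun b j => bY.repr (Pi.single b 1) j,
      fun c k => bV k c, fun a b c => ?_⟩⟩
  · rw [contract_eq_dual, hb]
    fin_cases k <;> simp
  · have e : t a b = arrBilin t (Pi.single a 1) (Pi.single b 1) := by
      simp [arrBilin_apply, Pi.single_apply]
    rw [e]
    conv_rhs => rw [← bX.sum_repr (Pi.single a 1), ← bY.sum_repr (Pi.single b 1)]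
    simp only [map_sum, map_smul, LinearMap.sum_apply, LinearMap.smul_apply, hb, Finset.sum_apply,
      Pi.smul_apply, smul_eq_mul, contract, mul_sum]
    rw [sum_comm]
    refine sum_congr rfl fun i _ => sum_congr rfl fun j _ => sum_congr rfl fun k _ => ?_
    ring

theorem exists_basis_slices (t : ι → κ → μ → K) :
    ∃ t' : Fin (Module.finrank K (Submodule.span K (Set.range t))) → κ → μ → K,
      ArrRestricts t t' ∧ ArrRestricts t' t := by
  classical
  let b := Module.finBasis K (Submodule.span K (Set.range t))
  have h₁ : ∀ i, ∃ x : ι → K, ∑ a, x a • t a = b i := fun i =>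
    (Submodule.mem_span_range_iff_exists_fun K).1 (b i).2
  choose x hx using h₁
  refine ⟨fun i => b i, ⟨x, fun j => Pi.single j 1, fun k => Pi.single k 1, fun i j k => ?_⟩,
    ⟨fun a i => b.repr ⟨t a, Submodule.subset_span ⟨a, rfl⟩⟩ i, fun j => Pi.single j 1,
      fun k => Pi.single k 1, fun a j k => ?_⟩⟩
  · change _ = (b i : κ → μ → K) j k
    rw [← hx]
    simp [contract, Pi.single_apply, Finset.sum_apply]
  · have := congrArg (fun v : Submodule.span K (Set.range t) => (v : κ → μ → K) j k)
      (b.sum_repr ⟨t a, Submodule.subset_span ⟨a, rfl⟩⟩)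
    simp only [Submodule.coe_sum, Submodule.coe_smul, Finset.sum_apply, Pi.smul_apply,
      smul_eq_mul] at this
    simpa [contract, Pi.single_apply] using this

theorem exists_smaller_of_not_linearIndependent {t : ι → κ → μ → K}
    (h : ¬ LinearIndependent K t) :
    ∃ n < Fintype.card ι, ∃ t' : Fin n → κ → μ → K, ArrRestricts t t' ∧ ArrRestricts t' t := by
  refine ⟨_, lt_of_le_of_ne (finrank_range_le_card t) fun he => h ?_, exists_basis_slices t⟩
  exact linearIndependent_iff_card_eq_finrank_span.2 he.symm

/-- Every array is equivalent to a concise one. -/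
theorem exists_concise (t : ι → κ → μ → K) :
    ∃ (a b c : ℕ) (t' : Fin a → Fin b → Fin c → K),
      Concise t' ∧ ArrRestricts t t' ∧ ArrRestricts t' t := by
  classical
  have hex : ∃ n, ∃ (a b c : ℕ) (t' : Fin a → Fin b → Fin c → K),
      a + b + c = n ∧ ArrRestricts t t' ∧ ArrRestricts t' t := by
    let e₁ := Fintype.equivFin ι
    let e₂ := Fintype.equivFin κ
    let e₃ := Fintype.equivFin μ
    exact ⟨_, _, _, _, fun i j k => t (e₁.symm i) (e₂.symm j) (e₃.symm k), rfl,
      .of_eq_comp e₁.symm e₂.symm e₃.symm fun _ _ _ => rfl,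
      .of_eq_comp e₁ e₂ e₃ fun _ _ _ => by simp⟩
  -- With a + b + c minimal, dependent slices in any direction would give a smaller equivalent
  -- array.
  obtain ⟨a, b, c, t', hn, h₁, h₂⟩ := Nat.find_spec hex
  refine ⟨a, b, c, t', ⟨?_, ?_, ?_⟩, h₁, h₂⟩
  · by_contra hli
    obtain ⟨n, hlt, s, hs, hs'⟩ := exists_smaller_of_not_linearIndependent hli
    rw [Fintype.card_fin] at hlt
    exact Nat.find_min hex (m := n + b + c) (by omega)
      ⟨n, b, c, s, rfl, h₁.trans hs, hs'.trans h₂⟩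
  · by_contra hli
    obtain ⟨n, hlt, s, hs, hs'⟩ := exists_smaller_of_not_linearIndependent hli
    rw [Fintype.card_fin] at hlt
    exact Nat.find_min hex (m := a + n + c) (by omega)
      ⟨a, n, c, rotate (rotate s), rfl, h₁.trans hs.rotate.rotate, hs'.rotate.rotate.trans h₂⟩
  · by_contra hli
    obtain ⟨n, hlt, s, hs, hs'⟩ := exists_smaller_of_not_linearIndependent hli
    rw [Fintype.card_fin] at hlt
    exact Nat.find_min hex (m := a + b + n) (by omega)
      ⟨a, b, n, rotate s, rfl, h₁.trans hs.rotate, hs'.rotate.trans h₂⟩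

end Concise

/-! ### Tensor squares of quadratic algebras. -/

section QuadraticAlgebra

variable {K : Type*} [Field K]

/-- Here s² - ps - q = (s - r)², and the matrices change between the bases 1, s and 1, s - r. -/
theorem quadArr_restricts_of_double_root {p q r : K} (hp : p = 2 * r) (hq : q = -r ^ 2) :
    ArrRestricts (quadArr p q) (quadArr (0 : K) 0) ∧
      ArrRestricts (quadArr (0 : K) 0) (quadArr p q) := by
  subst hp hq
  constructor
  · refine ⟨![![1, 0], ![-r, 1]], ![![1, 0], ![-r, 1]], ![![1, r], ![0, 1]], fun i j k => ?_⟩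
    fin_cases i <;> fin_cases j <;> fin_cases k <;>
      simp [contract, quadArr, Fin.sum_univ_two] <;> ring
  · refine ⟨![![1, 0], ![r, 1]], ![![1, 0], ![r, 1]], ![![1, -r], ![0, 1]], fun i j k => ?_⟩
    fin_cases i <;> fin_cases j <;> fin_cases k <;>
      simp [contract, quadArr, Fin.sum_univ_two] <;> ring

/-- Vectors of `K² ⊗ K²` from their four coordinates. -/
def vec4 (a b c d : K) (i : Fin 2 × Fin 2) : K := ![![a, b], ![c, d]] i.1 i.2

/-- Multiplication in A ⊗ A, in the basis 1⊗1, 1⊗s, s⊗1, s⊗s. -/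
theorem contract_arrKron_quadArr (p q a₀ a₁ a₂ a₃ b₀ b₁ b₂ b₃ c₀ c₁ c₂ c₃ : K) :
    contract (arrKron (quadArr p q) (quadArr p q)) (vec4 a₀ a₁ a₂ a₃) (vec4 b₀ b₁ b₂ b₃)
      (vec4 c₀ c₁ c₂ c₃) =
      c₀ * (a₀ * b₀ + q * (a₁ * b₁) + q * (a₂ * b₂ + q * (a₃ * b₃))) +
      c₁ * (a₀ * b₁ + a₁ * b₀ + p * (a₁ * b₁) + q * (a₂ * b₃ + a₃ * b₂ + p * (a₃ * b₃))) +
      c₂ * (a₀ * b₂ + q * (a₁ * b₃) + (a₂ * b₀ + q * (a₃ * b₁)) + p * (a₂ * b₂ + q * (a₃ * b₃))) +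
      c₃ * (a₀ * b₃ + a₁ * b₂ + p * (a₁ * b₃) + (a₂ * b₁ + a₃ * b₀ + p * (a₃ * b₁)) +
        p * (a₂ * b₃ + a₃ * b₂ + p * (a₃ * b₃))) := by
  simp [contract, quadArr, arrKron, vec4, Fintype.sum_prod_type, Fin.sum_univ_two]
  ring

set_option maxHeartbeats 4000000 in
theorem arrKron_quadArr_restricts_of_disc_ne_zero {p q : K} (h : p ^ 2 + 4 * q ≠ 0) :
    ArrRestricts (arrKron (quadArr p q) (quadArr p q))
      (arrKron (arrUnit K (Fin 2)) (quadArr p q)) := by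
  set d := p ^ 2 + 4 * q with hd
  -- The basis e, e(s⊗1), 1-e, (1-e)(s⊗1) of A ⊗ A, with e = (s⊗1 + 1⊗s - p)(2(s⊗1) - p)/d the
  -- separability idempotent.
  let X : Fin 2 × Fin 2 → Fin 2 × Fin 2 → K := fun i =>
    ![![vec4 ((2 * q + p ^ 2) / d) (-p / d) (-p / d) (2 / d),
      vec4 (-p * q / d) (2 * q / d) (2 * q / d) (p / d)],
      ![vec4 (2 * q / d) (p / d) (p / d) (-2 / d),
      vec4 (p * q / d) (-2 * q / d) ((2 * q + p ^ 2) / d) (-p / d)]] i.1 i.2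
  -- The coordinates of the two homomorphisms A ⊗ A → A that send s⊗1 to s and 1⊗s to s or to its
  -- conjugate p - s.
  refine ⟨X, X, fun i => ![![vec4 1 0 0 q, vec4 0 1 1 p], ![vec4 1 p 0 (-q), vec4 0 (-1) 1 0]]
    i.1 i.2, ?_⟩
  rintro ⟨i, i'⟩ ⟨j, j'⟩ ⟨k, k'⟩
  fin_cases i <;> fin_cases i' <;> fin_cases j <;> fin_cases j' <;> fin_cases k <;> fin_cases k' <;>
    simp [X, contract_arrKron_quadArr, quadArr, arrKron, arrUnit] <;> field_simp <;>
    simp only [hd] <;> ring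

theorem arrKron_quadArr_restricts_of_two_eq_zero {q : K} (h : (2 : K) = 0) :
    ArrRestricts (arrKron (quadArr 0 q) (quadArr 0 q))
      (arrKron (quadArr 0 0) (quadArr 0 q)) := by
  -- Put ε = s⊗1 + 1⊗s. In characteristic 2, ε² = 2q + 2(s⊗s) = 0. The vectors are 1, s⊗1, ε,
  -- ε(s⊗1), and the third family of forms is the dual basis.
  let X : Fin 2 × Fin 2 → Fin 2 × Fin 2 → K := fun i =>
    ![![vec4 1 0 0 0, vec4 0 0 1 0], ![vec4 0 1 1 0, vec4 q 0 0 1]] i.1 i.2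
  refine ⟨X, X, fun i => ![![vec4 1 0 0 q, vec4 0 1 1 0], ![vec4 0 1 0 0, vec4 0 0 0 1]] i.1 i.2,
    ?_⟩
  have h' : ∀ x : K, x + x = 0 := fun x => by rw [← two_mul, h, zero_mul]
  rintro ⟨i, i'⟩ ⟨j, j'⟩ ⟨k, k'⟩
  fin_cases i <;> fin_cases i' <;> fin_cases j <;> fin_cases j' <;> fin_cases k <;> fin_cases k' <;>
      simp [X, contract_arrKron_quadArr, quadArr, arrKron, h']

end QuadraticAlgebra

end TensorSubrank

namespace TensorSubrank

open Finset

/-! ### The upper bound for discriminant zero. -/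

section UpperBound

variable {K : Type*} [Field K]

theorem ArrRestricts.map {L : Type*} [Field L] (f : K →+* L) {ι κ μ ι' κ' μ' : Type} [Fintype ι]
    [Fintype κ] [Fintype μ] {t : ι → κ → μ → K} {s : ι' → κ' → μ' → K} (h : ArrRestricts t s) :
    ArrRestricts (fun a b c => f (t a b c)) (fun a b c => f (s a b c)) := by
  obtain ⟨X, Y, Z, h⟩ := h
  refine ⟨fun i a => f (X i a), fun i a => f (Y i a), fun i a => f (Z i a), fun i j k => ?_⟩
  simp only [← h, contract, map_sum, map_mul]

theorem add_eq_of_quadArr_ne_zero {a b c : Fin 2} (h : quadArr (0 : K) 0 a b c ≠ 0) :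
    (a : ℕ) + b = c := by
  fin_cases a <;> fin_cases b <;> fin_cases c <;> simp_all [quadArr]

/-- Chernoff's bound: 2^(N/3) · 2^(-∑ a) is at least 1 on the counted vectors, and its sum over all
vectors is (2^(1/3) · 3/2)^N. The weight 1/2 is the odds ratio of the density 1/3. -/
theorem card_filter_three_mul_sum_le (N : ℕ) :
    (#{a : Fin N → Fin 2 | 3 * ∑ n, (a n : ℕ) ≤ N} : ℝ) ≤ ((3 : ℝ) / 2 ^ ((2 : ℝ) / 3)) ^ N := by
  set ρ : ℝ := 2 ^ ((1 : ℝ) / 3) with hρ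
  have hρ1 : 1 ≤ ρ := Real.one_le_rpow (by norm_num) (by norm_num)
  have hρ3 : ρ ^ 3 = 2 := by
    rw [hρ, ← Real.rpow_natCast, ← Real.rpow_mul (by norm_num)]; norm_num
  have hρ2 : (2 : ℝ) ^ ((2 : ℝ) / 3) = ρ ^ 2 := by
    rw [hρ, ← Real.rpow_natCast, ← Real.rpow_mul (by norm_num)]; norm_num
  have hc : (3 : ℝ) / 2 ^ ((2 : ℝ) / 3) = ρ * (1 + 1 / 2) := by
    rw [hρ2, div_eq_iff (by positivity)]
    linear_combination -(3 / 2) * hρ3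
  rw [hc, mul_pow, Finset.card_eq_sum_ones, Nat.cast_sum]
  calc ∑ a : Fin N → Fin 2 with 3 * ∑ n, (a n : ℕ) ≤ N, ((1 : ℕ) : ℝ)
      ≤ ∑ a : Fin N → Fin 2 with 3 * ∑ n, (a n : ℕ) ≤ N, ρ ^ N * ∏ n, (1 / 2 : ℝ) ^ (a n : ℕ) := by
        refine sum_le_sum fun a ha => ?_
        have ha := (mem_filter.1 ha).2
        rw [prod_pow_eq_pow_sum, one_div, inv_pow, ← hρ3, ← pow_mul, Nat.cast_one,
          ← div_eq_mul_inv, le_div_iff₀ (by positivity), one_mul]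
        exact pow_le_pow_right₀ hρ1 ha
    _ ≤ ∑ a : Fin N → Fin 2, ρ ^ N * ∏ n, (1 / 2 : ℝ) ^ (a n : ℕ) :=
        sum_le_sum_of_subset_of_nonneg (filter_subset _ _) fun _ _ _ => by positivity
    _ = ρ ^ N * (1 + 1 / 2) ^ N := by
        rw [← mul_sum, ← Fintype.piFinset_univ,
          ← Finset.prod_univ_sum (fun _ => univ) fun _ (b : Fin 2) => (1 / 2 : ℝ) ^ (b : ℕ)]
        simp [Fin.sum_univ_two]

/-- On the support a + b + (1 - c) = 1 in each coordinate. The three coordinate sums add up to N, so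
one of them is at most N/3, and three sets of the size just counted cover the support. -/
theorem le_of_quadArr_zero_pow_restricts {N r : ℕ}
    (h : ArrRestricts (arrPow (quadArr (0 : K) 0) N) (arrUnit K (Fin r))) :
    (r : ℝ) ≤ 3 * ((3 : ℝ) / 2 ^ ((2 : ℝ) / 3)) ^ N := by
  classical
  set L : Finset (Fin N → Fin 2) := {a | 3 * ∑ n, (a n : ℕ) ≤ N} with hL
  set L' : Finset (Fin N → Fin 2) := L.map (Equiv.arrowCongr (.refl _) Fin.revPerm).toEmbedding
  have hle := le_card_of_restricts_unit _ L L L' (fun a b c hne => ?_) h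
  · have hcard : #L' = #L := card_map _
    have := card_filter_three_mul_sum_le N
    have hle' : (r : ℝ) ≤ #L + #L + #L := by rw [hcard] at hle; exact_mod_cast hle
    rw [← hL] at this
    linarith
  · have hn : ∀ n, (a n : ℕ) + b n + (Fin.rev (c n) : ℕ) = 1 := fun n => by
      have := add_eq_of_quadArr_ne_zero (prod_ne_zero_iff.1 hne n (mem_univ n))
      rw [Fin.val_rev]
      omega
    have hsum : ∑ n, (a n : ℕ) + ∑ n, (b n : ℕ) + ∑ n, (Fin.rev (c n) : ℕ) = N := by
      rw [← sum_add_distrib, ← sum_add_distrib, sum_congr rfl fun n _ => hn n]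
      simp
    have hc : c ∈ L' ↔ 3 * ∑ n, (Fin.rev (c n) : ℕ) ≤ N := by
      rw [mem_map_equiv, hL, mem_filter]
      simp
    rw [hc]
    simp only [hL, mem_filter, mem_univ, true_and]
    omega

/-- In characteristic 2 the double root may lie outside K. A restriction survives base change, so
the bound is taken over the algebraic closure. -/
theorem le_of_quadArr_pow_restricts {p q : K} (hd : p ^ 2 + 4 * q = 0) {N r : ℕ}
    (h : ArrRestricts (arrPow (quadArr p q) N) (arrUnit K (Fin r))) :
    (r : ℝ) ≤ 3 * ((3 : ℝ) / 2 ^ ((2 : ℝ) / 3)) ^ N := by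
  let f := algebraMap K (AlgebraicClosure K)
  obtain ⟨z, hz⟩ : ∃ z, f p = 2 * z ∧ f q = -z ^ 2 := by
    obtain ⟨z, hz⟩ := IsAlgClosed.exists_pow_nat_eq (-f q) (n := 2) (by norm_num)
    have h0 : f p ^ 2 + 4 * f q = 0 := by
      have := congrArg f hd
      simpa only [map_add, map_mul, map_pow, map_ofNat, map_zero] using this
    have : (f p - 2 * z) * (f p - 2 * -z) = 0 := by linear_combination h0 - 4 * hz
    rcases mul_eq_zero.1 this with h | h
    · exact ⟨z, sub_eq_zero.1 h, by linear_combination hz⟩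
    · exact ⟨-z, sub_eq_zero.1 h, by linear_combination hz⟩
  have h₁ : (fun a b c => f (arrPow (quadArr p q) N a b c)) = arrPow (quadArr (f p) (f q)) N := by
    have hq : ∀ a b c, f (quadArr p q a b c) = quadArr (f p) (f q) a b c := fun a b c => by
      fin_cases a <;> fin_cases b <;> fin_cases c <;> simp [quadArr]
    funext a b c
    simp only [arrPow, map_prod, hq]
  have h₂ : (fun a b c => f (arrUnit K (Fin r) a b c)) = arrUnit _ (Fin r) := by
    funext a b c
    simp only [arrUnit]
    split_ifs <;> simp
  have h₃ := h.map f
  rw [h₁, h₂] at h₃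
  exact le_of_quadArr_zero_pow_restricts
    (((quadArr_restricts_of_double_root hz.1 hz.2).2.pow N).trans h₃)

end UpperBound

/-! ### Counting pairs of disjoint sets. -/

section LowerBound

variable {ι : Type} [Fintype ι] [DecidableEq ι]

/-- For `i₀` in exactly one of `s`, `t`, the M translates of the solution set along coordinate `i₀`
are disjoint: two distinct subset sums collide with probability at most 1/M. -/
theorem card_sum_eq_sum_mul_le {M : ℕ} [NeZero M] {s t : Finset ι} (h : s ≠ t) :
    #{w : ι → ZMod M | ∑ i ∈ s, w i = ∑ i ∈ t, w i} * M ≤ M ^ Fintype.card ι := by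
  obtain ⟨i₀, hi₀⟩ : ∃ i, ¬ (i ∈ s ↔ i ∈ t) := by
    by_contra! hall
    exact h (Finset.ext hall)
  have hcard : M ^ Fintype.card ι = #(univ : Finset (ι → ZMod M)) := by
    rw [card_univ, Fintype.card_fun, ZMod.card]
  set S : Finset (ι → ZMod M) := {w | ∑ i ∈ s, w i = ∑ i ∈ t, w i} with hS
  have hM : #S * M = #(S ×ˢ (univ : Finset (ZMod M))) := by
    rw [card_product, card_univ, ZMod.card]
  rw [hcard, hM]
  refine card_le_card_of_injOn (fun p => p.1 + Pi.single i₀ p.2) (fun _ _ => mem_univ _) ?_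
  rintro ⟨w, c⟩ hw ⟨w', c'⟩ hw' heq
  simp only [hS, coe_product, Set.mem_prod, mem_coe, mem_filter, mem_univ, true_and, and_true]
    at hw hw' heq
  have e₁ : ∀ u : Finset ι, ∑ i ∈ u, w i + (if i₀ ∈ u then c else 0) =
      ∑ i ∈ u, w' i + (if i₀ ∈ u then c' else 0) := fun u => by
    have := congrArg (fun v : ι → ZMod M => ∑ i ∈ u, v i) heq
    simpa [sum_add_distrib, Pi.single_apply] using this
  have hc : c = c' := by
    have h₁ := e₁ s
    have h₂ := e₁ t
    by_cases hs : i₀ ∈ s <;> by_cases ht : i₀ ∈ t <;> simp [hs, ht] at hi₀ h₁ h₂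
    · rw [hw, hw', h₂] at h₁
      exact add_left_cancel h₁
    · rw [← hw, ← hw', h₁] at h₂
      exact add_left_cancel h₂
  subst hc
  exact Prod.ext (add_right_cancel heq) rfl

/-- Pairs of disjoint `n`-element sets. -/
def disjointPairs (ι : Type) [Fintype ι] [DecidableEq ι] (n : ℕ) : Finset (Finset ι × Finset ι) :=
  {e | #e.1 = n ∧ #e.2 = n ∧ Disjoint e.1 e.2}

theorem mem_disjointPairs {n : ℕ} {e : Finset ι × Finset ι} :
    e ∈ disjointPairs ι n ↔ #e.1 = n ∧ #e.2 = n ∧ Disjoint e.1 e.2 := by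
  simp [disjointPairs]

/-- Two pairs of sets share the first set, the second set, or the union. -/
def Meets (e e' : Finset ι × Finset ι) : Prop :=
  e.1 = e'.1 ∨ e.2 = e'.2 ∨ e.1 ∪ e.2 = e'.1 ∪ e'.2

theorem card_filter_fst_eq {n : ℕ} (hι : Fintype.card ι = 3 * n) {x : Finset ι} (hx : #x = n) :
    #{e ∈ disjointPairs ι n | e.1 = x} = n.centralBinom := by
  have : ({e ∈ disjointPairs ι n | e.1 = x} : Finset _) =
      (powersetCard n xᶜ).image fun y => (x, y) := by
    ext ⟨a, b⟩
    simp only [mem_filter, mem_disjointPairs, mem_image, mem_powersetCard, Prod.mk.injEq,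
      subset_compl_iff_disjoint_left]
    constructor
    · rintro ⟨⟨-, hb, hd⟩, rfl⟩
      exact ⟨b, ⟨hd, hb⟩, rfl, rfl⟩
    · rintro ⟨y, ⟨hd, hy⟩, rfl, rfl⟩
      exact ⟨⟨hx, hy, hd⟩, rfl⟩
  rw [this, card_image_of_injective _ (Prod.mk_right_injective x), card_powersetCard, card_compl,
    hι, hx, Nat.centralBinom]
  congr 1
  omega

theorem card_disjointPairs {n : ℕ} (hι : Fintype.card ι = 3 * n) :
    #(disjointPairs ι n) = (3 * n).choose n * n.centralBinom := by
  rw [card_eq_sum_card_fiberwise (f := Prod.fst) (t := powersetCard n univ)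
    (fun e he => by simpa using (mem_disjointPairs.1 he).1),
    sum_congr rfl fun x hx => card_filter_fst_eq hι (mem_powersetCard.1 hx).2,
    sum_const, card_powersetCard, card_univ, hι, smul_eq_mul]

/-- Fixing the first set, the second set, or the union leaves at most C(2n, n) pairs each. -/
theorem card_meets_le {n : ℕ} (hι : Fintype.card ι = 3 * n) {e : Finset ι × Finset ι}
    (he : e ∈ disjointPairs ι n) [DecidablePred (Meets e)] :
    #{e' ∈ disjointPairs ι n | Meets e e'} ≤ 3 * n.centralBinom := by
  obtain ⟨h₁, h₂, hd⟩ := mem_disjointPairs.1 he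
  have hsub : ({e' ∈ disjointPairs ι n | Meets e e'} : Finset _) ⊆
      (({e' ∈ disjointPairs ι n | e'.1 = e.1} ∪
        ({e' ∈ disjointPairs ι n | e'.1 = e.2} : Finset _).image Prod.swap) ∪
        (powersetCard n (e.1 ∪ e.2)).image fun x => (x, (e.1 ∪ e.2) \ x)) := by
    intro e' he'
    obtain ⟨he', hm⟩ := mem_filter.1 he'
    have hd' := mem_disjointPairs.1 he'
    simp only [mem_union, mem_filter, mem_image, he', true_and]
    rcases hm with h | h | h
    · exact Or.inl (Or.inl h.symm)
    · exact Or.inl (Or.inr ⟨e'.swap, ⟨mem_disjointPairs.2 ⟨hd'.2.1, hd'.1, hd'.2.2.symm⟩, h.symm⟩,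
        Prod.swap_swap _⟩)
    · refine Or.inr ⟨e'.1, mem_powersetCard.2 ⟨h ▸ subset_union_left, hd'.1⟩, ?_⟩
      rw [h, union_sdiff_cancel_left hd'.2.2]
  refine (card_le_card hsub).trans ((card_union_le _ _).trans ?_)
  have a₁ := card_filter_fst_eq hι h₁
  have a₂ := card_filter_fst_eq hι h₂
  have a₃ : #((powersetCard n (e.1 ∪ e.2)).image fun x => (x, (e.1 ∪ e.2) \ x)) ≤
      n.centralBinom := by
    refine card_image_le.trans ?_
    rw [card_powersetCard, card_union_of_disjoint hd, h₁, h₂, Nat.centralBinom, two_mul]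
  have a₄ := card_union_le {e' ∈ disjointPairs ι n | e'.1 = e.1}
    (({e' ∈ disjointPairs ι n | e'.1 = e.2} : Finset _).image Prod.swap)
  have a₅ : #(({e' ∈ disjointPairs ι n | e'.1 = e.2} : Finset _).image Prod.swap) ≤ _ :=
    card_image_le
  omega

end LowerBound

end TensorSubrank

namespace TensorSubrank

open Finset

/-! ### Random hashing with progression-free sets. -/

section Hashing

variable {ι : Type} [Fintype ι] [DecidableEq ι] {M : ℕ}

/-- The hash function selecting pairs of sets. -/
abbrev Hash (ι : Type) (M : ℕ) : Type := (ι → ZMod M) × ZMod M × ZMod M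

/-- The pair `e` is selected by the hash function `ω` with value `b`. -/
def Selects (ω : Hash ι M) (e : Finset ι × Finset ι) (b : ℕ) : Prop :=
  ∑ i ∈ e.1, ω.1 i + ω.2.1 = b ∧ ∑ i ∈ e.2, ω.1 i + ω.2.2 = b

open scoped Classical in
/-- The pairs selected by the hash function `ω` with a value in `B`. -/
noncomputable def selected (n : ℕ) (B : Finset ℕ) (ω : Hash ι M) :
    Finset (Finset ι × Finset ι) :=
  {e ∈ disjointPairs ι n | ∃ b ∈ B, Selects ω e b}

open scoped Classical in
/-- The selected pairs which meet no other selected pair. -/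
noncomputable def isolated (n : ℕ) (B : Finset ℕ) (ω : Hash ι M) :
    Finset (Finset ι × Finset ι) :=
  {e ∈ selected n B ω | ∀ e' ∈ selected n B ω, Meets e e' → e = e'}

theorem natCast_inj_of_lt {a b : ℕ} (ha : a < M) (hb : b < M) (h : (a : ZMod M) = b) : a = b := by
  rw [ZMod.natCast_eq_natCast_iff] at h
  exact Nat.ModEq.eq_of_lt_of_lt h ha hb

/-- The hash values satisfy b + b' = 2c modulo M = 2m, hence in ℕ since all are below m, and
progression-freeness gives b = c = b'. So the mixed pair `(e.1, e'.2)` is selected as well; it meets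
all three pairs, and isolation makes them equal to it. -/
theorem isolated_induced {n m : ℕ} {B : Finset ℕ} (hB : B ⊆ range m) (hB' : ThreeAPFree (B : Set ℕ))
    (hM : M = 2 * m) {ω : Hash ι M} {e e' e'' : Finset ι × Finset ι} (he : e ∈ isolated n B ω)
    (he' : e' ∈ isolated n B ω) (he'' : e'' ∈ isolated n B ω) (hd : Disjoint e.1 e'.2)
    (hu : e.1 ∪ e'.2 = e''.1 ∪ e''.2) : e = e' ∧ e' = e'' := by
  classical
  simp only [isolated, selected, mem_filter] at he he' he''
  obtain ⟨⟨hE, b, hb, hs, -⟩, hiso⟩ := he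
  obtain ⟨⟨hE', b', hb', -, hs'⟩, hiso'⟩ := he'
  obtain ⟨⟨hE'', c, hc, hs₁, hs₂⟩, hiso''⟩ := he''
  rw [mem_disjointPairs] at hE hE' hE''
  have hsum : ((b + b' : ℕ) : ZMod M) = ((c + c : ℕ) : ZMod M) := by
    push_cast
    rw [← hs, ← hs']
    nth_rw 1 [← hs₁]
    rw [← hs₂]
    have := congrArg (fun u => ∑ i ∈ u, ω.1 i) hu
    simp only [sum_union hd, sum_union hE''.2.2] at this
    linear_combination this
  have hlt := mem_range.1 (hB hb)
  have hlt' := mem_range.1 (hB hb')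
  have hltc := mem_range.1 (hB hc)
  have hsum' := natCast_inj_of_lt (by omega) (by omega) hsum
  have hbc : b = c := hB' hb hc hb' hsum'
  have hbb : b = b' := by omega
  subst hbb
  have hf : (e.1, e'.2) ∈ disjointPairs ι n ∧ ∃ b ∈ B, Selects ω (e.1, e'.2) b :=
    ⟨mem_disjointPairs.2 ⟨hE.1, hE'.2.1, hd⟩, b, hb, hs, hs'⟩
  have h₁ := hiso _ hf (Or.inl rfl)
  have h₂ := hiso' _ hf (Or.inr (Or.inl rfl))
  have h₃ := hiso'' _ hf (Or.inr (Or.inr hu.symm))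
  exact ⟨h₁.trans h₂.symm, h₂.trans h₃.symm⟩

theorem arrPow_restricts_isolated (K : Type*) [Field K] {N n m : ℕ} {B : Finset ℕ}
    (hB : B ⊆ range m) (hB' : ThreeAPFree (B : Set ℕ)) (hM : M = 2 * m) (ω : Hash (Fin N) M) :
    ArrRestricts (arrPow (quadArr (0 : K) 0) N) (arrUnit K (Fin #(isolated n B ω))) := by
  classical
  let g := (isolated n B ω).equivFin.symm
  let ind : Finset (Fin N) → Fin N → Fin 2 := fun s l => if l ∈ s then 1 else 0
  refine .of_eq_comp (fun i => ind (g i).1.1) (fun i => ind (g i).1.2)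
    (fun i => ind ((g i).1.1 ∪ (g i).1.2)) fun i j k => ?_
  have hval : ∀ x y u : Finset (Fin N), arrPow (quadArr (0 : K) 0) N (ind x) (ind y) (ind u) =
      if Disjoint x y ∧ x ∪ y = u then 1 else 0 := by
    intro x y u
    have hl : ∀ l, quadArr (0 : K) 0 (ind x l) (ind y l) (ind u l) =
        if ¬ (l ∈ x ∧ l ∈ y) ∧ ((l ∈ x ∨ l ∈ y) ↔ l ∈ u) then 1 else 0 := by
      intro l
      by_cases hx : l ∈ x <;> by_cases hy : l ∈ y <;> by_cases hu : l ∈ u <;>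
        simp [ind, quadArr, hx, hy, hu]
    simp only [arrPow, hl, Finset.prod_ite_zero, prod_const_one, mem_univ, true_implies]
    refine if_congr ?_ rfl rfl
    simp only [disjoint_left, Finset.ext_iff, mem_union, forall_and, not_and]
  rw [hval, arrUnit]
  refine if_congr ⟨fun ⟨hd, hu⟩ => ?_, ?_⟩ rfl rfl
  · have := isolated_induced hB hB' hM (g i).2 (g j).2 (g k).2 hd hu
    exact ⟨g.injective (Subtype.ext this.1), g.injective (Subtype.ext this.2)⟩
  · rintro ⟨rfl, rfl⟩
    have := (g i).2
    simp only [isolated, selected, mem_filter, mem_disjointPairs] at this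
    exact ⟨this.1.1.2.2, rfl⟩

variable [NeZero M]

-- The weights and the value b are free, and they determine the two shifts.
open scoped Classical in
theorem le_card_selects {B : Finset ℕ} (hB : B ⊆ range M) (e : Finset ι × Finset ι) :
    M ^ Fintype.card ι * #B ≤ #{ω : Hash ι M | ∃ b ∈ B, Selects ω e b} := by
  have hcard : M ^ Fintype.card ι * #B = #((univ : Finset (ι → ZMod M)) ×ˢ B) := by
    rw [card_product, card_univ, Fintype.card_fun, ZMod.card]
  rw [hcard]
  refine card_le_card_of_injOn
    (fun p => (p.1, (p.2 : ZMod M) - ∑ i ∈ e.1, p.1 i, (p.2 : ZMod M) - ∑ i ∈ e.2, p.1 i)) ?_ ?_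
  · rintro ⟨w, b⟩ h
    simp only [coe_product, Set.mem_prod, mem_coe] at h
    simp only [mem_coe, mem_filter, mem_univ, true_and]
    exact ⟨b, h.2, by simp [Selects]⟩
  · rintro ⟨w, b⟩ h ⟨w', b'⟩ h' heq
    simp only [coe_product, Set.mem_prod, mem_coe] at h h'
    simp only [Prod.mk.injEq] at heq
    obtain ⟨rfl, h₁, -⟩ := heq
    rw [natCast_inj_of_lt (mem_range.1 (hB h.2)) (mem_range.1 (hB h'.2)) (sub_left_injective h₁)]

-- Joint selection of two meeting pairs forces a collision of subset sums. A common union gives 2b =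
-- 2b' modulo 2m, so again b = b' by the size of `B`.
omit [Fintype ι] [NeZero M] in
theorem exists_sum_eq_of_meets {m : ℕ} {B : Finset ℕ} (hB : B ⊆ range m) (hM : M = 2 * m)
    {e e' : Finset ι × Finset ι} (hd : Disjoint e.1 e.2) (hd' : Disjoint e'.1 e'.2) (hne : e ≠ e')
    (hm : Meets e e') : ∃ s t : Finset ι, s ≠ t ∧ ∀ ω : Hash ι M,
      (∃ b ∈ B, Selects ω e b) → (∃ b ∈ B, Selects ω e' b) → ∑ i ∈ s, ω.1 i = ∑ i ∈ t, ω.1 i := by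
  rcases hm with h | h | h
  · refine ⟨e.2, e'.2, fun h' => hne (Prod.ext h h'), ?_⟩
    rintro ω ⟨b, -, hs, ht⟩ ⟨b', -, hs', ht'⟩
    rw [h] at hs
    linear_combination ht - ht' - hs + hs'
  · refine ⟨e.1, e'.1, fun h' => hne (Prod.ext h' h), ?_⟩
    rintro ω ⟨b, -, hs, ht⟩ ⟨b', -, hs', ht'⟩
    rw [h] at ht
    linear_combination hs - hs' - ht + ht'
  · refine ⟨e.1, e'.1, fun h' => hne (Prod.ext h' ?_), ?_⟩
    · rw [← union_sdiff_cancel_left hd, h, h', union_sdiff_cancel_left hd']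
    · rintro ω ⟨b, hb, hs, ht⟩ ⟨b', hb', hs', ht'⟩
      have := congrArg (fun u => ∑ i ∈ u, ω.1 i) h
      simp only [sum_union hd, sum_union hd'] at this
      have hlt := mem_range.1 (hB hb)
      have hlt' := mem_range.1 (hB hb')
      have hbb := natCast_inj_of_lt (M := M) (a := b + b) (b := b' + b') (by omega) (by omega) (by
        push_cast
        linear_combination this - hs - ht + hs' + ht')
      obtain rfl : b = b' := by omega
      linear_combination hs - hs'

open scoped Classical in
theorem card_selects_both_le {m : ℕ} {B : Finset ℕ} (hB : B ⊆ range m) (hM : M = 2 * m)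
    {e e' : Finset ι × Finset ι} (hd : Disjoint e.1 e.2) (hd' : Disjoint e'.1 e'.2) (hne : e ≠ e')
    (hm : Meets e e') :
    #{ω : Hash ι M | (∃ b ∈ B, Selects ω e b) ∧ ∃ b ∈ B, Selects ω e' b} * M ≤
      M ^ Fintype.card ι * #B := by
  obtain ⟨s, t, hst, hω⟩ := exists_sum_eq_of_meets hB hM hd hd' hne hm
  refine le_trans ?_ (Nat.mul_le_mul_right #B (card_sum_eq_sum_mul_le (M := M) hst))
  rw [mul_right_comm, ← card_product]
  refine Nat.mul_le_mul_right _ ?_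
  let β : Hash ι M → ℕ := fun ω => if h : ∃ b ∈ B, Selects ω e b then h.choose else 0
  have hβ : ∀ ω, (∃ b ∈ B, Selects ω e b) → β ω ∈ B ∧ Selects ω e (β ω) := fun ω h => by
    simp only [β, dif_pos h]
    exact h.choose_spec
  refine card_le_card_of_injOn (fun ω => (ω.1, β ω)) ?_ ?_
  · intro ω h
    simp only [mem_coe, mem_filter, mem_univ, true_and] at h
    simp only [coe_product, Set.mem_prod, mem_coe, mem_filter, mem_univ, true_and]
    exact ⟨hω ω h.1 h.2, (hβ ω h.1).1⟩
  · rintro ⟨w, u, v⟩ h ⟨w', u', v'⟩ h' heq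
    simp only [mem_coe, mem_filter, mem_univ, true_and] at h h'
    have h₁ := (hβ _ h.1).2
    have h₂ := (hβ _ h'.1).2
    simp only [Prod.mk.injEq] at heq
    rw [heq.2] at h₁
    obtain ⟨rfl, -⟩ := heq
    simp only [Selects] at h₁ h₂
    exact Prod.ext rfl (Prod.ext (add_left_cancel (h₁.1.trans h₂.1.symm))
      (add_left_cancel (h₁.2.trans h₂.2.symm)))

/-- First moment method over the P·M² hash functions. Each pair is selected by at least P·#B of
them, and each conflict by at most P·#B/M. Every pair meets at most 3D others, so M = 6D keeps the
conflicts below half of the selections. Some ω then isolates at least #E·#B/(2M²) pairs; 72 = 2·6².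
-/
theorem exists_isolated_card_ge {n : ℕ} (hι : Fintype.card ι = 3 * n) {B : Finset ℕ}
    (hB : B ⊆ range (3 * n.centralBinom)) (hM : M = 2 * (3 * n.centralBinom)) :
    ∃ ω : Hash ι M, (3 * n).choose n * #B ≤ 72 * n.centralBinom * #(isolated n B ω) := by
  classical
  set D := n.centralBinom with hD
  have hDpos : 0 < D := n.centralBinom_pos
  set E := disjointPairs ι n with hE
  set P := M ^ Fintype.card ι with hP
  let C : Finset ((Finset ι × Finset ι) × (Finset ι × Finset ι)) :=
    {c ∈ E ×ˢ E | c.1 ≠ c.2 ∧ Meets c.1 c.2}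
  let Cω : Hash ι M → Finset ((Finset ι × Finset ι) × (Finset ι × Finset ι)) := fun ω =>
    {c ∈ C | (∃ b ∈ B, Selects ω c.1 b) ∧ ∃ b ∈ B, Selects ω c.2 b}
  have hCcard : #C ≤ #E * (3 * D) := by
    rw [card_eq_sum_card_fiberwise (f := Prod.fst) (t := E)
      (fun c hc => (mem_product.1 (mem_filter.1 hc).1).1)]
    refine (sum_le_card_nsmul _ _ (3 * D) fun e he => ?_).trans_eq (smul_eq_mul _ _)
    refine le_trans ?_ (card_meets_le hι he)
    refine card_le_card_of_injOn Prod.snd ?_ ?_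
    · intro c hc
      simp only [mem_coe, mem_filter, mem_product] at hc
      simp only [mem_coe, mem_filter]
      obtain ⟨⟨⟨-, h⟩, -, hm⟩, rfl⟩ := hc
      exact ⟨h, hm⟩
    · intro c hc c' hc' h
      simp only [mem_coe, mem_filter] at hc hc'
      exact Prod.ext (hc.2.trans hc'.2.symm) h
  have hsel : ∀ ω, #(selected n B ω) ≤ #(isolated n B ω) + #(Cω ω) := by
    intro ω
    refine le_trans (card_le_card (t := isolated n B ω ∪ (Cω ω).image Prod.fst) ?_)
      ((card_union_le _ _).trans (Nat.add_le_add_left card_image_le _))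
    intro e he
    rw [mem_union]
    by_cases hi : e ∈ isolated n B ω
    · exact Or.inl hi
    right
    simp only [isolated, mem_filter, not_and, not_forall] at hi
    obtain ⟨e', he', hm, hne⟩ := hi he
    simp only [selected, mem_filter] at he he'
    exact mem_image.2 ⟨(e, e'), mem_filter.2 ⟨mem_filter.2
      ⟨mem_product.2 ⟨he.1, he'.1⟩, hne, hm⟩, he.2, he'.2⟩, rfl⟩
  have hsum₁ : #E * (P * #B) ≤ ∑ ω : Hash ι M, #(selected n B ω) := by
    simp only [selected, card_filter]
    rw [sum_comm]
    refine (smul_eq_mul _ _).symm.trans_le (card_nsmul_le_sum _ _ _ fun e _ => ?_)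
    rw [← card_filter]
    exact le_card_selects (hB.trans (range_subset_range.2 (by omega))) e
  have hsum₂ : (∑ ω : Hash ι M, #(Cω ω)) * M ≤ #C * (P * #B) := by
    simp only [Cω, card_filter]
    rw [sum_comm, sum_mul]
    refine (sum_le_card_nsmul _ _ (P * #B) fun c hc => ?_).trans_eq (smul_eq_mul _ _)
    rw [← card_filter]
    simp only [C, mem_filter, mem_product] at hc
    exact card_selects_both_le hB hM (mem_disjointPairs.1 hc.1.1).2.2
      (mem_disjointPairs.1 hc.1.2).2.2 hc.2.1 hc.2.2
  have hsum₃ : ∑ ω : Hash ι M, #(selected n B ω) ≤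
      ∑ ω : Hash ι M, #(isolated n B ω) + ∑ ω : Hash ι M, #(Cω ω) := by
    rw [← sum_add_distrib]
    exact sum_le_sum fun ω _ => hsel ω
  by_contra! hlt
  have hEcard : #E = (3 * n).choose n * D := card_disjointPairs hι
  have hMpos : 0 < M := by omega
  have hsum₄ : (∑ ω : Hash ι M, #(isolated n B ω)) * (72 * D) < P * M * M * ((3 * n).choose n * #B) := by
    have hcard : Fintype.card (Hash ι M) = P * M * M := by
      rw [Fintype.card_prod, Fintype.card_prod, Fintype.card_fun, ZMod.card, hP, mul_assoc]
    rw [← hcard, ← card_univ, ← smul_eq_mul (#univ), ← sum_const, sum_mul]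
    exact sum_lt_sum_of_nonempty univ_nonempty fun ω _ => by
      rw [mul_comm]; exact hlt ω
  have hC2 : (∑ ω : Hash ι M, #(Cω ω)) * 2 ≤ #E * (P * #B) := by
    have h := hsum₂.trans (Nat.mul_le_mul_right (P * #B) hCcard)
    refine Nat.le_of_mul_le_mul_right ?_ (show 0 < 3 * D by omega)
    calc _ = (∑ ω : Hash ι M, #(Cω ω)) * M :=
          (mul_assoc _ _ _).trans (congrArg _ hM.symm)
      _ ≤ _ := h
      _ = _ := by ring
  have hI : #E * (P * #B) ≤ (∑ ω : Hash ι M, #(isolated n B ω)) * 2 := by omega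
  have : #E * (P * #B) * (36 * D) ≤ (∑ ω : Hash ι M, #(isolated n B ω)) * (72 * D) := by
    calc _ ≤ (∑ ω : Hash ι M, #(isolated n B ω)) * 2 * (36 * D) := Nat.mul_le_mul_right _ hI
      _ = _ := by ring
  refine absurd (this.trans_lt hsum₄) (not_lt.2 (le_of_eq ?_))
  rw [hEcard, hM]
  ring

theorem exists_quadArr_zero_pow_restricts (K : Type*) [Field K] (n : ℕ) :
    ∃ r, ArrRestricts (arrPow (quadArr (0 : K) 0) (3 * n)) (arrUnit K (Fin r)) ∧
      (3 * n).choose n * rothNumberNat (3 * n.centralBinom) ≤ 72 * n.centralBinom * r := by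
  obtain ⟨B, hB, hcard, hfree⟩ := rothNumberNat_spec (3 * n.centralBinom)
  have : NeZero (2 * (3 * n.centralBinom)) := ⟨by have := n.centralBinom_pos; omega⟩
  obtain ⟨ω, hω⟩ := exists_isolated_card_ge (ι := Fin (3 * n)) (Fintype.card_fin _) hB rfl
  exact ⟨_, arrPow_restricts_isolated K hB hfree rfl ω, hcard ▸ hω⟩

end Hashing

end TensorSubrank

namespace TensorSubrank

open Finset Filter Asymptotics

/-! ### Asymptotic rates. -/

section Growth

theorem isLittleO_sqrt_succ : (fun N : ℕ => √((N : ℝ) + 1)) =o[atTop] fun N : ℕ => (N : ℝ) := by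
  have h' : Tendsto (fun N : ℕ => √((N : ℝ) + 1)) atTop atTop :=
    Real.tendsto_sqrt_atTop.comp
      (tendsto_atTop_add_const_right _ _ tendsto_natCast_atTop_atTop)
  have h₁ : (fun _ : ℕ => (1 : ℝ)) =o[atTop] fun N : ℕ => √((N : ℝ) + 1) :=
    isLittleO_const_left.2 (Or.inr (tendsto_norm_atTop_atTop.comp h'))
  have h₂ : (fun N : ℕ => (N : ℝ) + 1) =O[atTop] fun N : ℕ => (N : ℝ) := by
    refine IsBigO.of_bound 2 ((eventually_ge_atTop 1).mono fun N hN => ?_)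
    have : (1 : ℝ) ≤ N := by exact_mod_cast hN
    rw [Real.norm_of_nonneg (by positivity), Real.norm_of_nonneg (by positivity)]
    linarith
  refine (((isBigO_refl _ _).mul_isLittleO h₁).congr (fun N => mul_one _) fun N => ?_).trans_isBigO h₂
  exact Real.mul_self_sqrt (by positivity)

/-- The function f is forced to be N - log a(N) / log c, and the two bounds make it O(√(N + 1)). -/
theorem eqPowSubLittleO_of_bounds {a : ℕ → ℕ} {c A B : ℝ} (hc : 1 < c) (ha : ∀ N, 0 < a N)
    (hB : 0 ≤ B) (hA : 0 ≤ A) (hle : ∀ N : ℕ, Real.log (a N) ≤ N * Real.log c + B)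
    (hge : ∀ N : ℕ, N * Real.log c - A * √((N : ℝ) + 1) ≤ Real.log (a N)) : EqPowSubLittleO a c := by
  have hlog : 0 < Real.log c := Real.log_pos hc
  refine ⟨fun N => N - Real.log (a N) / Real.log c, ?_, fun N => ?_⟩
  · refine IsBigO.trans_isLittleO (IsBigO.of_bound ((A + B) / Real.log c)
      (Eventually.of_forall fun N => ?_)) isLittleO_sqrt_succ
    have hs : 1 ≤ √((N : ℝ) + 1) := Real.one_le_sqrt.2 (by linarith [Nat.cast_nonneg (α := ℝ) N])
    rw [Real.norm_of_nonneg (Real.sqrt_nonneg _), Real.norm_eq_abs, abs_le]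
    have e : (N : ℝ) - Real.log (a N) / Real.log c =
        (N * Real.log c - Real.log (a N)) / Real.log c := by field_simp
    rw [e, div_mul_eq_mul_div, ← neg_div]
    have h₁ := hle N
    have h₂ := hge N
    have h₃ : B ≤ B * √((N : ℝ) + 1) := le_mul_of_one_le_right hB hs
    have h₄ : 0 ≤ A * √((N : ℝ) + 1) := by positivity
    constructor
    · exact div_le_div_of_nonneg_right (by nlinarith) hlog.le
    · exact div_le_div_of_nonneg_right (by nlinarith) hlog.le
  · have : (0 : ℝ) < a N := by exact_mod_cast ha N
    rw [sub_sub_cancel, Real.rpow_def_of_pos (by linarith), mul_div_cancel₀ _ hlog.ne',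
      Real.exp_log this]

theorem EqPowSubLittleO.not_gePowSubLittleO {a : ℕ → ℕ} {c d : ℝ} (hc : 0 < c) (hcd : c < d)
    (h : EqPowSubLittleO a c) : ¬ GePowSubLittleO a d := by
  rintro ⟨g, hg, hge⟩
  obtain ⟨f, hf, heq⟩ := h
  have hd : 0 < d := hc.trans hcd
  have hlog : 0 < Real.log d - Real.log c := sub_pos.2 (Real.log_lt_log hc hcd)
  have ho : (fun N : ℕ => (N : ℝ)) =o[atTop] fun N : ℕ => (N : ℝ) := by
    refine IsBigO.trans_isLittleO (g := fun N => Real.log d * g N - Real.log c * f N) ?_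
      ((hg.const_mul_left _).sub (hf.const_mul_left _))
    refine IsBigO.of_bound (Real.log d - Real.log c)⁻¹ (Eventually.of_forall fun N => ?_)
    have hN := hge N
    rw [heq N, ← Real.log_le_log_iff (Real.rpow_pos_of_pos hd _) (Real.rpow_pos_of_pos hc _),
      Real.log_rpow hd, Real.log_rpow hc] at hN
    rw [Real.norm_of_nonneg (Nat.cast_nonneg N), ← div_eq_inv_mul, le_div_iff₀ hlog]
    refine le_trans ?_ (Real.le_norm_self _)
    linarith
  have := (ho.def (c := 1 / 2) (by norm_num)).and (eventually_ge_atTop 1)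
  obtain ⟨N, hN, hN1⟩ := this.exists
  rw [Real.norm_of_nonneg (Nat.cast_nonneg N)] at hN
  have : (1 : ℝ) ≤ N := by exact_mod_cast hN1
  linarith

theorem EqPowSubLittleO.gePowSubLittleO {a : ℕ → ℕ} {c : ℝ} (h : EqPowSubLittleO a c) :
    GePowSubLittleO a c := by
  obtain ⟨f, hf, heq⟩ := h
  exact ⟨f, hf, fun N => (heq N).ge⟩

theorem eqPowSubLittleO_one {a : ℕ → ℕ} (h : ∀ N, a N = 1) : EqPowSubLittleO a 1 :=
  ⟨fun _ => 0, isLittleO_zero _ _, fun N => by simp [h]⟩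

theorem rate_pow_three : ((3 : ℝ) / 2 ^ ((2 : ℝ) / 3)) ^ 3 = 27 / 4 := by
  rw [div_pow, ← Real.rpow_natCast (2 ^ ((2 : ℝ) / 3)), ← Real.rpow_mul (by norm_num)]
  norm_num

theorem one_lt_rate : 1 < (3 : ℝ) / 2 ^ ((2 : ℝ) / 3) := by
  refine lt_of_pow_lt_pow_left₀ 3 (by positivity) ?_
  rw [rate_pow_three]; norm_num

theorem rate_lt_two : (3 : ℝ) / 2 ^ ((2 : ℝ) / 3) < 2 := by
  refine lt_of_pow_lt_pow_left₀ 3 (by positivity) ?_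
  rw [rate_pow_three]; norm_num

/-- Induction on the ratio of consecutive binomials, which falls short of 27/4 = c₃³ by no more than
the growth of 3n + 1 makes up. -/
theorem pow_le_mul_choose_three_mul (n : ℕ) :
    (27 / 4 : ℝ) ^ n ≤ (3 * n + 1) * ((3 * n).choose n : ℝ) := by
  induction n with
  | zero => simp
  | succ n ih =>
    have h₁ := Nat.add_one_mul_choose_eq (3 * n + 2) n
    have h₂ := Nat.choose_mul_succ_eq (3 * n + 1) n
    have h₃ := Nat.choose_mul_succ_eq (3 * n) n
    rw [show 3 * n + 1 + 1 - n = 2 * n + 2 by omega] at h₂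
    rw [show 3 * n + 1 - n = 2 * n + 1 by omega] at h₃
    rify at h₁ h₂ h₃
    rw [show 3 * (n + 1) = 3 * n + 2 + 1 by ring]
    set x : ℝ := ((3 * n + 2 + 1).choose (n + 1) : ℝ)
    set y : ℝ := ((3 * n + 2).choose n : ℝ)
    set z : ℝ := ((3 * n + 1).choose n : ℝ)
    set u : ℝ := ((3 * n).choose n : ℝ)
    have hu : 0 ≤ u := Nat.cast_nonneg _
    have hn : (0 : ℝ) ≤ n := Nat.cast_nonneg _
    have key : x * ((n + 1) * (2 * n + 2) * (2 * n + 1)) =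
        (3 * n + 3) * (3 * n + 2) * (3 * n + 1) * u := by
      linear_combination -(2 * n + 2) * (2 * n + 1) * h₁ - (3 * n + 3) * (2 * n + 1) * h₂ -
        (3 * n + 3) * (3 * n + 2) * h₃
    have hpos : (0 : ℝ) < (n + 1) * (2 * n + 2) * (2 * n + 1) := by positivity
    refine le_of_mul_le_mul_right ?_ hpos
    push_cast
    have e : (3 * (n + 1) + 1) * x * ((n + 1) * (2 * n + 2) * (2 * n + 1)) =
        (3 * n + 4) * ((3 * n + 3) * (3 * n + 2) * (3 * n + 1) * u) := by
      rw [← key]; ring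
    rw [e, pow_succ]
    refine (mul_le_mul_of_nonneg_right (mul_le_mul_of_nonneg_right ih (by norm_num)) hpos.le).trans ?_
    have hfac : (27 / 4 : ℝ) * ((n + 1) * (2 * n + 2) * (2 * n + 1)) ≤
        (3 * n + 4) * ((3 * n + 3) * (3 * n + 2)) := by
      nlinarith [mul_nonneg hn hn, mul_nonneg hn (mul_nonneg hn hn)]
    calc _ = (3 * n + 1) * u * ((27 / 4 : ℝ) * ((n + 1) * (2 * n + 2) * (2 * n + 1))) := by ring
      _ ≤ (3 * n + 1) * u * ((3 * n + 4) * ((3 * n + 3) * (3 * n + 2))) := by gcongr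
      _ = _ := by ring

/-- Write s = √(N + 1). Behrend's bound costs 8s, because log(3D) ≤ 4s²; the factor 3n + 1 costs 2s,
the constant 24 = 72/3 costs 4, and rounding N down to 3n costs 3. As s ≥ 1, the total is at most
17s. -/
theorem log_ge_of_choose_mul_roth_le {n r N : ℕ} (h₁ : 3 * n ≤ N) (h₂ : N ≤ 3 * n + 3)
    (h : (3 * n).choose n * rothNumberNat (3 * n.centralBinom) ≤ 72 * n.centralBinom * r) :
    N * Real.log ((3 : ℝ) / 2 ^ ((2 : ℝ) / 3)) - 17 * √((N : ℝ) + 1) ≤ Real.log r := by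
  set c := (3 : ℝ) / 2 ^ ((2 : ℝ) / 3) with hc
  set D := n.centralBinom with hD
  have hDpos : (0 : ℝ) < D := by exact_mod_cast n.centralBinom_pos
  have hN₁ : (3 : ℝ) * n ≤ N := by exact_mod_cast h₁
  have hN₂ : (N : ℝ) ≤ 3 * n + 3 := by exact_mod_cast h₂
  have hn : (0 : ℝ) ≤ n := Nat.cast_nonneg _
  set s := √((N : ℝ) + 1) with hs
  have hs1 : 1 ≤ s := Real.one_le_sqrt.2 (by linarith)
  have hss : s ^ 2 = N + 1 := Real.sq_sqrt (by linarith)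
  have hlogD : Real.log (3 * D) ≤ 4 * s ^ 2 := by
    have hD4 : (D : ℝ) ≤ 4 ^ n := by
      have : D ≤ 2 ^ (2 * n) := Nat.choose_le_two_pow _ _
      rw [pow_mul] at this
      exact_mod_cast this
    have h3 : Real.log 3 ≤ 2 := by
      have := Real.log_le_sub_one_of_pos (show (0 : ℝ) < 3 by norm_num); linarith
    have h4 : Real.log 4 ≤ 3 := by
      have := Real.log_le_sub_one_of_pos (show (0 : ℝ) < 4 by norm_num); linarith
    calc Real.log (3 * D) ≤ Real.log (3 * 4 ^ n) :=
          Real.log_le_log (by positivity) (by gcongr)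
      _ = Real.log 3 + n * Real.log 4 := by
          rw [Real.log_mul (by norm_num) (by positivity), Real.log_pow]
      _ ≤ 2 + n * 3 := by gcongr
      _ ≤ 4 * s ^ 2 := by rw [hss]; linarith
  have hsqrt : √(Real.log (3 * D)) ≤ 2 * s := by
    rw [show 2 * s = √(4 * s ^ 2) by
      rw [show 4 * s ^ 2 = (2 * s) ^ 2 by ring, Real.sqrt_sq (by linarith)]]
    exact Real.sqrt_le_sqrt hlogD
  have hroth : 3 * D * Real.exp (-8 * s) ≤ rothNumberNat (3 * D) := by
    have := Behrend.roth_lower_bound (N := 3 * D)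
    push_cast at this
    refine le_trans (mul_le_mul_of_nonneg_left (Real.exp_le_exp.2 ?_) (by positivity)) this
    linarith
  have hr : ((3 * n).choose n : ℝ) * Real.exp (-8 * s) ≤ 24 * r := by
    have h' : ((3 * n).choose n : ℝ) * rothNumberNat (3 * D) ≤ 72 * D * r := by exact_mod_cast h
    have := (mul_le_mul_of_nonneg_left hroth (Nat.cast_nonneg ((3 * n).choose n))).trans h'
    refine le_of_mul_le_mul_right ?_ (show (0 : ℝ) < 3 * D by positivity)
    linarith
  have hmain : c ^ (3 * n) * Real.exp (-8 * s) ≤ 24 * (3 * n + 1) * r := by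
    rw [pow_mul, rate_pow_three]
    calc _ ≤ (3 * n + 1) * ((3 * n).choose n : ℝ) * Real.exp (-8 * s) := by
          gcongr; exact pow_le_mul_choose_three_mul n
      _ = (3 * n + 1) * (((3 * n).choose n : ℝ) * Real.exp (-8 * s)) := by ring
      _ ≤ (3 * n + 1) * (24 * r) := by gcongr
      _ = _ := by ring
  have hc1 : 1 < c := one_lt_rate
  have hpos : 0 < c ^ (3 * n) * Real.exp (-8 * s) := by positivity
  have hrpos : (0 : ℝ) < r := by
    rcases Nat.eq_zero_or_pos r with rfl | h0
    · rw [Nat.cast_zero, mul_zero] at hmain; linarith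
    · exact_mod_cast h0
  have hlog := Real.log_le_log hpos hmain
  rw [Real.log_mul (by positivity) (by positivity), Real.log_pow, Real.log_exp,
    Real.log_mul (by positivity) hrpos.ne', Real.log_mul (by norm_num) (by positivity)] at hlog
  have hlogc : Real.log c ≤ 1 := by
    have := Real.log_le_sub_one_of_pos (show 0 < c by linarith)
    have := rate_lt_two
    linarith
  have hlogc0 : 0 ≤ Real.log c := Real.log_nonneg hc1.le
  have h24 : Real.log 24 ≤ 4 := by
    rw [Real.log_le_iff_le_exp (by norm_num)]
    have := Real.exp_one_gt_d9
    calc (24 : ℝ) ≤ 2.7 ^ 4 := by norm_num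
      _ ≤ Real.exp 1 ^ 4 := by gcongr; linarith
      _ = Real.exp 4 := by rw [← Real.exp_nat_mul]; norm_num
  have hlogn : Real.log (3 * n + 1) ≤ 2 * s := by
    calc Real.log (3 * n + 1) ≤ Real.log (s ^ 2) :=
          Real.log_le_log (by positivity) (by rw [hss]; linarith)
      _ = 2 * Real.log s := by rw [Real.log_pow]; norm_num
      _ ≤ 2 * s := by
        have := Real.log_le_sub_one_of_pos (show 0 < s by linarith); linarith
  have hNc : N * Real.log c ≤ 3 * n * Real.log c + 3 := by
    nlinarith [mul_le_mul_of_nonneg_right hN₂ hlogc0]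
  push_cast at hlog
  linarith

end Growth

/-! ### The three cases. -/

section Classification

variable {K : Type*} [Field K]

theorem arrPow_restricts_arrPow_of_le {ι κ μ : Type} [Fintype ι] [Fintype κ] [Fintype μ]
    {t : ι → κ → μ → K} (ht : t ≠ 0) {M N : ℕ} (h : M ≤ N) :
    ArrRestricts (arrPow t N) (arrPow t M) := by
  induction N, h using Nat.le_induction with
  | base => exact .refl _
  | succ N _ ih =>
    refine ((arrPow_succ_restricts_arrKron t N).trans
      ((ArrRestricts.refl _).kron (restricts_unit_one_of_ne_zero ht))).trans (.trans ?_ ih)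
    exact .of_eq_comp (fun i => (i, 0)) (fun i => (i, 0)) (fun i => (i, 0)) fun _ _ _ => by
      simp [arrKron, arrUnit]

theorem quadArr_ne_zero (p q : K) : quadArr p q ≠ 0 := fun h => by
  have := congrFun (congrFun (congrFun h 0) 0) 0
  simp [quadArr] at this

/-- In characteristic 2 one factor is spent as a catalyst, whence N + 1; otherwise the double root
p/2 is in K and the spare factor is dropped. -/
theorem quadArr_pow_succ_restricts_of_disc_eq_zero {p q : K} (h : p ^ 2 + 4 * q = 0) (N : ℕ) :
    ArrRestricts (arrPow (quadArr p q) (N + 1)) (arrPow (quadArr (0 : K) 0) N) := by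
  by_cases h2 : (2 : K) = 0
  · obtain rfl : p = 0 := by
      have : p ^ 2 = 0 := by linear_combination h - 2 * q * h2
      simpa using this
    exact arrPow_succ_restricts_of_arrKron_self (quadArr_ne_zero 0 q)
      (arrKron_quadArr_restricts_of_two_eq_zero h2) N
  · have h4 : (4 : K) ≠ 0 := by
      rw [show (4 : K) = 2 * 2 by norm_num]; exact mul_ne_zero h2 h2
    refine (arrPow_restricts_arrPow_of_le (quadArr_ne_zero p q) N.le_succ).trans
      ((quadArr_restricts_of_double_root (r := p / 2) ?_ ?_).1.pow N)
    · field_simp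
    · field_simp
      refine mul_left_cancel₀ h4 ?_
      linear_combination 4 * h

variable {n₁ n₂ n₃ : ℕ} (T : Tensor3 K n₁ n₂ n₃)

theorem one_le_subrank_kroneckerPow {T : Tensor3 K n₁ n₂ n₃} (hT : T ≠ 0) (N : ℕ) :
    1 ≤ subrank (kroneckerPow T N) := by
  refine le_subrank_kroneckerPow T ?_
  have ht : coeff T ≠ 0 := fun h => hT (coeff_injective (h.trans (by funext i j k; simp)))
  have := (restricts_unit_one_of_ne_zero ht).pow_unit N
  rwa [one_pow] at this

theorem exactlyOne_of_eq_one {a : ℕ → ℕ} (h : ∀ N, a N = 1) :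
    ExactlyOne (∀ N, a N = 1) (EqPowSubLittleO a ((3 : ℝ) / 2 ^ ((2 : ℝ) / 3)))
      (GePowSubLittleO a 2) :=
  .inl ⟨h, fun h' => (eqPowSubLittleO_one h).not_gePowSubLittleO one_pos one_lt_rate
    h'.gePowSubLittleO, (eqPowSubLittleO_one h).not_gePowSubLittleO one_pos one_lt_two⟩

theorem exactlyOne_of_eqPowSubLittleO {a : ℕ → ℕ}
    (h : EqPowSubLittleO a ((3 : ℝ) / 2 ^ ((2 : ℝ) / 3))) :
    ExactlyOne (∀ N, a N = 1) (EqPowSubLittleO a ((3 : ℝ) / 2 ^ ((2 : ℝ) / 3)))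
      (GePowSubLittleO a 2) :=
  .inr (.inl ⟨fun h' => (eqPowSubLittleO_one h').not_gePowSubLittleO one_pos one_lt_rate
    h.gePowSubLittleO, h, h.not_gePowSubLittleO (by positivity) rate_lt_two⟩)

theorem exactlyOne_of_gePowSubLittleO {a : ℕ → ℕ} (h : GePowSubLittleO a 2) :
    ExactlyOne (∀ N, a N = 1) (EqPowSubLittleO a ((3 : ℝ) / 2 ^ ((2 : ℝ) / 3)))
      (GePowSubLittleO a 2) :=
  .inr (.inr ⟨fun h' => (eqPowSubLittleO_one h').not_gePowSubLittleO one_pos one_lt_two h,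
    fun h' => h'.not_gePowSubLittleO (by positivity) rate_lt_two h, h⟩)

theorem gePowSubLittleO_two_of_le {a : ℕ → ℕ} (h : ∀ N, 2 ^ N ≤ 2 * a N) :
    GePowSubLittleO a 2 := by
  refine ⟨fun _ => 1, (isLittleO_const_left.2 (Or.inr ?_)), fun N => ?_⟩
  · exact tendsto_norm_atTop_atTop.comp tendsto_natCast_atTop_atTop
  · rw [Real.rpow_sub_one two_ne_zero, Real.rpow_natCast, div_le_iff₀ two_pos, mul_comm]
    exact_mod_cast h N

theorem eqPowSubLittleO_subrank_of_disc_eq_zero {T : Tensor3 K n₁ n₂ n₃} (hT : T ≠ 0) {p q : K}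
    (h : ArrRestricts (coeff T) (quadArr p q)) (h' : ArrRestricts (quadArr p q) (coeff T))
    (hd : p ^ 2 + 4 * q = 0) :
    EqPowSubLittleO (fun N => subrank (kroneckerPow T N)) ((3 : ℝ) / 2 ^ ((2 : ℝ) / 3)) := by
  have hpos : ∀ N, 0 < subrank (kroneckerPow T N) := one_le_subrank_kroneckerPow hT
  refine eqPowSubLittleO_of_bounds (A := 17) (B := Real.log 3) one_lt_rate hpos
    (Real.log_nonneg (by norm_num)) (by norm_num) (fun N => ?_) fun (N : ℕ) => ?_
  · have hle : (subrank (kroneckerPow T N) : ℝ) ≤ 3 * ((3 : ℝ) / 2 ^ ((2 : ℝ) / 3)) ^ N := by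
      refine le_trans (Nat.cast_le.2 (subrank_kroneckerPow_le T
        (R := ⌊3 * ((3 : ℝ) / 2 ^ ((2 : ℝ) / 3)) ^ N⌋₊) fun r hr => Nat.le_floor ?_))
        (Nat.floor_le (by positivity))
      exact le_of_quadArr_pow_restricts hd ((h'.pow N).trans hr)
    have := Real.log_le_log (by exact_mod_cast hpos N) hle
    rw [Real.log_mul (by norm_num) (by positivity), Real.log_pow] at this
    linarith
  -- One of the N factors is the catalyst, so 3n ≤ N - 1; truncated subtraction covers N = 0.
  · obtain ⟨r, hr, hle⟩ := exists_quadArr_zero_pow_restricts K ((N - 1) / 3)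
    refine (log_ge_of_choose_mul_roth_le (N := N) (by omega) (by omega) hle).trans ?_
    rcases Nat.eq_zero_or_pos r with rfl | hr0
    -- Here `Real.log 0 = 0`.
    · simpa using Real.log_natCast_nonneg _
    refine Real.log_le_log (by exact_mod_cast hr0) (Nat.cast_le.2 (le_subrank_kroneckerPow T ?_))
    refine (h.pow N).trans (.trans ?_ hr)
    rcases Nat.eq_zero_or_pos N with rfl | hN
    · exact arrPow_zero_restricts _ _
    · obtain ⟨M, rfl⟩ : ∃ M, N = M + 1 := ⟨N - 1, by omega⟩
      exact (quadArr_pow_succ_restricts_of_disc_eq_zero hd M).trans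
        (arrPow_restricts_arrPow_of_le (quadArr_ne_zero 0 0) (by omega))

theorem two_pow_le_subrank_of_disc_ne_zero {T : Tensor3 K n₁ n₂ n₃} (hT : T ≠ 0) {p q : K}
    (h : ArrRestricts (coeff T) (quadArr p q)) (hd : p ^ 2 + 4 * q ≠ 0) (N : ℕ) :
    2 ^ N ≤ 2 * subrank (kroneckerPow T N) := by
  cases N with
  | zero => have := one_le_subrank_kroneckerPow hT 0; omega
  | succ N =>
    rw [pow_succ, mul_comm]
    refine Nat.mul_le_mul_left 2 (le_subrank_kroneckerPow T ((h.pow _).trans ?_))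
    refine (arrPow_succ_restricts_of_arrKron_self (quadArr_ne_zero p q)
      (arrKron_quadArr_restricts_of_disc_ne_zero hd) N).trans ?_
    rw [arrPow_arrUnit]
    exact arrUnit_restricts_of_card_le (by simp)

end Classification

end TensorSubrank

theorem mainTheorem4 {K : Type*} [Field K] {n₁ n₂ n₃ : ℕ}
    (T : TensorSubrank.Tensor3 K n₁ n₂ n₃) (hT : T ≠ 0) :
    TensorSubrank.ExactlyOne
      (∀ N : ℕ, TensorSubrank.subrank (TensorSubrank.kroneckerPow T N) = 1)
      (TensorSubrank.EqPowSubLittleO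
        (fun N => TensorSubrank.subrank (TensorSubrank.kroneckerPow T N))
        ((3 : ℝ) / (2 : ℝ) ^ ((2 : ℝ) / 3)))
      (TensorSubrank.GePowSubLittleO
        (fun N => TensorSubrank.subrank (TensorSubrank.kroneckerPow T N)) 2) := by
  open TensorSubrank in
  obtain ⟨a, b, c, t, hcon, h, h'⟩ := exists_concise (coeff T)
  have ht : t ≠ 0 := by
    rintro rfl
    obtain ⟨X, Y, Z, hXYZ⟩ := h'
    refine hT (coeff_injective ?_)
    funext i j k
    rw [← hXYZ, coeff_zero]
    simp [contract]
  -- A nonzero array has an index in each direction, so a, b, c are at least 1.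
  obtain ⟨i, hi⟩ := Function.ne_iff.1 ht
  obtain ⟨j, hj⟩ := Function.ne_iff.1 hi
  obtain ⟨k, -⟩ := Function.ne_iff.1 hj
  -- In a direction of dimension 1, every power has a single slice, so its slice rank is at most 1.
  have hone : (a = 1 ∨ b = 1 ∨ c = 1) → ∀ N, subrank (kroneckerPow T N) = 1 := by
    intro habc N
    refine le_antisymm (subrank_kroneckerPow_le T fun r hr => ?_) (one_le_subrank_kroneckerPow hT N)
    have hr' := (h'.pow N).trans hr
    rcases habc with rfl | rfl | rfl
    · simpa using le_card_of_restricts_unit _ Finset.univ ∅ ∅ (fun _ _ _ _ => by simp only [Finset.mem_univ, true_or]) hr'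
    · simpa using le_card_of_restricts_unit _ ∅ Finset.univ ∅ (fun _ _ _ _ => by simp only [Finset.mem_univ, true_or, or_true]) hr'
    · simpa using le_card_of_restricts_unit _ ∅ ∅ Finset.univ (fun _ _ _ _ => by simp only [Finset.mem_univ, or_true]) hr'
  by_cases h1 : a = 1 ∨ b = 1 ∨ c = 1
  · exact exactlyOne_of_eq_one (hone h1)
  have hi' := i.isLt
  have hj' := j.isLt
  have hk' := k.isLt
  by_cases h3 : 3 ≤ a ∨ 3 ≤ b ∨ 3 ≤ c
  · refine exactlyOne_of_gePowSubLittleO (gePowSubLittleO_two_of_le fun N => ?_)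
    have h2 : ArrRestricts t (arrUnit K (Fin 2)) := by
      refine hcon.restricts_unit_two ?_ ?_ ?_ ?_ <;> simp only [Fintype.card_fin] <;> omega
    have := le_subrank_kroneckerPow T ((h.trans h2).pow_unit N)
    omega
  · obtain ⟨p, q, hp, hp'⟩ := hcon.exists_quadArr (by rw [Fintype.card_fin]; omega)
      (by rw [Fintype.card_fin]; omega) (by rw [Fintype.card_fin]; omega)
    by_cases hd : p ^ 2 + 4 * q = 0
    · exact exactlyOne_of_eqPowSubLittleO
        (eqPowSubLittleO_subrank_of_disc_eq_zero hT (h.trans hp) (hp'.trans h') hd)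
    · exact exactlyOne_of_gePowSubLittleO (gePowSubLittleO_two_of_le
        (two_pow_le_subrank_of_disc_ne_zero hT (h.trans hp) hd))
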